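/- Let $G=\mathrm{GL}_n(F_q)$, where $n\ge 2$ and $F_q$ is a finite field of characteristic $p$. Let $\ell\neq p$ be a prime and let $R$ be a local principal ideal domain of characteristic $0$ with maximal ideal $\ell R$, containing a primitive $p$-th root of unity; put $K=R/\ell R$. Let $B$ be the subgroup of upper triangular matrices of $G$, view $S_n$ as the group of permutation matrices in $G$, and let $$I=RG\cdot\mathbf{e},\qquad \mathbf{e}=\sum_{\sigma\in S_n}\mathrm{sg}(\sigma)\,\sigma\sum_{x\in B}x .$$ Let $f:I\times I\to R$ be the restriction to $I$ of the $R$-bilinear form on $RG$ with $(g,h)\mapsto\delta_{g,h}$ for $g,h\in G$, scaled by $1/|B|$. For an integer $c\ge 0$ let $I(c)=\{x\in I : f(x,I)\subseteq \ell^cR\}$, an $RG$-submodule of $I$ (a Steinberg lattice), and let $T^c=I(c)/\ell I(c)$ be the corresponding $KG$-module. An integer $a\ge 0$ is called a $\mathcal{P}$-value if there is a subgroup $P$ of $G$ containing $B$ such that $\ell^a\mid [G:P]$ and $\ell^{a+1}\nmid[G:P]$. Let $b=\nu_\ell([G:B])$, the largest $\mathcal{P}$-value. Let $0\le c<h$ be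 integers such that some $\mathcal{P}$-value $a$ satisfies $c<a\le h$. Then the $KG$-modules $T^c$ and $T^h$ are not isomorphic; consequently, the $RG$-modules $I(c)$ and $I(h)$ are not isomorphic. On the other hand, $I(b)\cong I(b+1)\cong I(b+2)\cong\cdots$ as $RG$-modules, so $T^b\cong T^{b+1}\cong T^{b+2}\cong\cdots$ as $KG$-modules. -/

import Mathlib

open scoped MonoidAlgebra

noncomputable section

namespace SteinbergLattice

section Group

variable (n : ℕ) (F : Type*) [Field F]

/-- The group `B` of upper triangular matrices in `GL_n(F)`. -/
def borel : Subgroup (GL (Fin n) F) where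
  carrier := {g | ∀ i j : Fin n, j < i → (g : Matrix (Fin n) (Fin n) F) i j = 0}
  one_mem' := fun i j h => by simp [Matrix.one_apply_ne h.ne']
  mul_mem' := by
    intro a b ha hb i j h
    exact Matrix.BlockTriangular.mul (b := (id : Fin n → Fin n))
      (fun i j h => ha i j h) (fun i j h => hb i j h) h
  inv_mem' := by
    intro a ha i j h
    have : Matrix.BlockTriangular ((a : Matrix (Fin n) (Fin n) F)⁻¹) (id : Fin n → Fin n) := by
      have : Invertible (a : Matrix (Fin n) (Fin n) F) := a.invertible
      exact Matrix.blockTriangular_inv_of_blockTriangular (fun i j h => ha i j h)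
    rw [Matrix.coe_units_inv]
    exact this h

/-- The embedding of the symmetric group into `GL_n(F)` by permutation matrices. -/
def permGL : Equiv.Perm (Fin n) →* GL (Fin n) F :=
  (Matrix.permMatrixHom : Equiv.Perm (Fin n) →* Matrix (Fin n) (Fin n) F).toHomUnits

/-- The permutation matrix of `σ` sends the basis vector `e_i` to `e_{σ(i)}`. -/
theorem permGL_mulVec (σ : Equiv.Perm (Fin n)) (i : Fin n) :
    ((permGL n F σ : GL (Fin n) F) : Matrix (Fin n) (Fin n) F).mulVec (Pi.single i 1) =
      Pi.single (σ i) 1 := by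
  change ((σ⁻¹).permMatrix F).mulVec (Pi.single i 1) = _
  rw [Matrix.permMatrix_mulVec]
  ext j
  simp [Pi.single_apply, Equiv.symm_apply_eq]

/-- A subgroup of `GL_n(F)` is a standard parabolic subgroup if it contains `B`. -/
def IsStandardParabolic (P : Subgroup (GL (Fin n) F)) : Prop := borel n F ≤ P

/-- `c` is a `𝒫`-value: `ℓ ^ c` is the exact power of `ℓ` dividing `[G : P]` for some standard
parabolic subgroup `P`. -/
def IsPValue (ℓ c : ℕ) : Prop :=
  ∃ P : Subgroup (GL (Fin n) F), IsStandardParabolic n F P ∧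
    ℓ ^ c ∣ P.index ∧ ¬ ℓ ^ (c + 1) ∣ P.index

/-- The number `b`: the `ℓ`-adic valuation of `[G : B]`. -/
def maxPValue (ℓ : ℕ) : ℕ := padicValNat ℓ (borel n F).index

/-- `b` is the largest `𝒫`-value. -/
theorem isGreatest_maxPValue [Finite F] {ℓ : ℕ} (hℓ : ℓ.Prime) :
    IsGreatest {c | IsPValue n F ℓ c} (maxPValue n F ℓ) := by
  have : Fact ℓ.Prime := ⟨hℓ⟩
  have h0 : (borel n F).index ≠ 0 := Subgroup.index_ne_zero_of_finite
  refine ⟨⟨borel n F, le_refl _, pow_padicValNat_dvd, pow_succ_padicValNat_not_dvd h0⟩, ?_⟩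
  rintro c ⟨P, hP, hc, -⟩
  exact (padicValNat_dvd_iff_le h0).1 (hc.trans (Subgroup.index_dvd_of_le hP))

end Group

section Lattice

variable (n : ℕ) (F : Type*) [Field F] [Finite F] (R : Type*) [CommRing R]

/-- `Ŝ`, the sum in `RG` of the elements of a subset `S` of the finite group `G`. -/
def hatSum {G : Type*} [Group G] [Finite G] (S : Set G) : R[G] :=
  ∑ g ∈ S.toFinite.toFinset, MonoidAlgebra.of R G g

/-- The element `𝐞 = ∑_{σ ∈ S_n} sg(σ) σ B̂` of `RG`. -/
def steinbergElement : R[GL (Fin n) F] :=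
  ∑ σ : Equiv.Perm (Fin n), ((Equiv.Perm.sign σ : ℤˣ) : ℤ) •
    (MonoidAlgebra.of R (GL (Fin n) F) (permGL n F σ) * hatSum R (borel n F : Set (GL (Fin n) F)))

/-- The Steinberg lattice `I = RG · 𝐞`, a left ideal of `RG`. -/
def steinberg : Submodule R[GL (Fin n) F] R[GL (Fin n) F] :=
  Submodule.span R[GL (Fin n) F] {steinbergElement n F R}

/-- The canonical bilinear form on the group algebra of a finite group,
`(g, h) ↦ δ_{g,h}` on group elements. -/
def canonicalForm (G : Type*) [Group G] [Finite G] : LinearMap.BilinForm R R[G] :=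
  letI := Fintype.ofFinite G
  LinearMap.mk₂ R (fun x y => ∑ g : G, x.coeff g * y.coeff g)
    (by intro x x' y; simp [add_mul, Finset.sum_add_distrib])
    (by intro r x y; simp [Finset.mul_sum, mul_assoc])
    (by intro x y y'; simp [mul_add, Finset.sum_add_distrib])
    (by intro r x y; simp [Finset.mul_sum, mul_left_comm])

/-- The `G`-invariant form `f` on the Steinberg lattice: the restriction to `I` of the canonical
form, scaled by `1 / |B|`. As the elements of `I` have coefficients that are constant on the left
cosets of `B`, this is the sum over `G / B` of the products of the coefficients; see
`card_mul_steinbergForm`. -/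
def steinbergForm : LinearMap.BilinForm R (steinberg n F R) :=
  letI := Fintype.ofFinite (GL (Fin n) F ⧸ borel n F)
  LinearMap.mk₂ R (fun x y => ∑ t : GL (Fin n) F ⧸ borel n F,
      (x : R[GL (Fin n) F]).coeff t.out * (y : R[GL (Fin n) F]).coeff t.out)
    (by intro x x' y; simp [add_mul, Finset.sum_add_distrib])
    (by intro r x y; simp [Finset.mul_sum, mul_assoc])
    (by intro x y y'; simp [mul_add, Finset.sum_add_distrib])
    (by intro r x y; simp [Finset.mul_sum, mul_left_comm])

variable {n F R}

theorem canonicalForm_apply {G : Type*} [Group G] [Fintype G] (x y : R[G]) :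
    canonicalForm R G x y = ∑ g : G, x.coeff g * y.coeff g := by
  unfold canonicalForm
  simp only [LinearMap.mk₂_apply]
  exact Finset.sum_congr (by ext; simp) fun _ _ => rfl

theorem canonicalForm_of {G : Type*} [Group G] [Finite G] [DecidableEq G] (g h : G) :
    canonicalForm R G (MonoidAlgebra.of R G g) (MonoidAlgebra.of R G h) =
      if g = h then 1 else 0 := by
  let _ := Fintype.ofFinite G
  rw [canonicalForm_apply]
  simp [MonoidAlgebra.of_apply, MonoidAlgebra.coeff_single, Finsupp.single_apply]

theorem canonicalForm_of_mul {G : Type*} [Group G] [Finite G] (g : G) (x y : R[G]) :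
    canonicalForm R G (MonoidAlgebra.of R G g * x) y =
      canonicalForm R G x (MonoidAlgebra.of R G g⁻¹ * y) := by
  let _ := Fintype.ofFinite G
  rw [canonicalForm_apply, canonicalForm_apply]
  refine Fintype.sum_equiv (Equiv.mulLeft g⁻¹) _ _ fun h => ?_
  simp [MonoidAlgebra.of_apply]

theorem hatSum_mul_of {G : Type*} [Group G] [Finite G] (H : Subgroup G) {b : G} (hb : b ∈ H) :
    hatSum R (H : Set G) * MonoidAlgebra.of R G b = hatSum R (H : Set G) := by
  unfold hatSum
  rw [Finset.sum_mul]
  refine Finset.sum_equiv (Equiv.mulRight b) ?_ ?_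
  · intro g
    simp [H.mul_mem_cancel_right hb]
  · intro g _
    simp

theorem coeff_mul_right_of_mem {x : R[GL (Fin n) F]} (hx : x ∈ steinberg n F R)
    (g : GL (Fin n) F) {b : GL (Fin n) F} (hb : b ∈ borel n F) :
    x.coeff (g * b) = x.coeff g := by
  obtain ⟨a, rfl⟩ := Submodule.mem_span_singleton.1 hx
  have h : steinbergElement n F R * MonoidAlgebra.of R _ b = steinbergElement n F R := by
    unfold steinbergElement
    rw [Finset.sum_mul]
    refine Finset.sum_congr rfl fun σ _ => ?_
    rw [smul_mul_assoc, mul_assoc, hatSum_mul_of _ hb]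
  have h2 : a • steinbergElement n F R =
      (a • steinbergElement n F R) * MonoidAlgebra.of R _ b := by
    rw [smul_mul_assoc, h]
  conv_lhs => rw [h2]
  simp [MonoidAlgebra.of_apply]

/-- The form `f` is the canonical form divided by `|B|`. -/
theorem card_mul_steinbergForm (x y : steinberg n F R) :
    (Nat.card (borel n F) : R) * steinbergForm n F R x y =
      canonicalForm R (GL (Fin n) F) x y := by
  let _ := Fintype.ofFinite (GL (Fin n) F)
  let _ := Fintype.ofFinite (GL (Fin n) F ⧸ borel n F)
  let _ := Fintype.ofFinite (borel n F)
  rw [canonicalForm_apply]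
  have hbij : Function.Bijective
      (fun p : (GL (Fin n) F ⧸ borel n F) × borel n F => p.1.out * (p.2 : GL (Fin n) F)) := by
    constructor
    · rintro ⟨t, u⟩ ⟨t', u'⟩ h
      have ht : t = t' := by
        have h1 := congrArg (fun g : GL (Fin n) F => (g : GL (Fin n) F ⧸ borel n F)) h
        simpa [QuotientGroup.mk_mul_of_mem] using h1
      subst ht
      simpa using h
    · intro g
      refine ⟨⟨(g : GL (Fin n) F ⧸ borel n F),
        ⟨(g : GL (Fin n) F ⧸ borel n F).out⁻¹ * g, QuotientGroup.eq.1 (by simp)⟩⟩, by simp⟩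
  rw [← Equiv.sum_comp (Equiv.ofBijective _ hbij), Fintype.sum_prod_type]
  simp only [Equiv.ofBijective_apply, coeff_mul_right_of_mem x.2 _ (SetLike.coe_mem _),
    coeff_mul_right_of_mem y.2 _ (SetLike.coe_mem _), Finset.sum_const, Finset.card_univ,
    nsmul_eq_mul, Nat.card_eq_fintype_card, ← Finset.mul_sum]
  rfl

variable [IsDomain R] [CharZero R]

theorem steinbergForm_smul (a : R[GL (Fin n) F]) (x : steinberg n F R) :
    ∀ y : steinberg n F R, ∃ z : steinberg n F R,
      steinbergForm n F R (a • x) y = steinbergForm n F R x z := by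
  have hB : (Nat.card (borel n F) : R) ≠ 0 := Nat.cast_ne_zero.2 Nat.card_pos.ne'
  induction a using MonoidAlgebra.induction_on with
  | of g =>
    intro y
    refine ⟨MonoidAlgebra.of R _ g⁻¹ • y, mul_left_cancel₀ hB ?_⟩
    rw [card_mul_steinbergForm, card_mul_steinbergForm]
    exact canonicalForm_of_mul g _ _
  | add a b ha hb =>
    intro y
    obtain ⟨z, hz⟩ := ha y
    obtain ⟨w, hw⟩ := hb y
    exact ⟨z + w, by rw [add_smul, map_add, LinearMap.add_apply, hz, hw, map_add]⟩
  | smul r a ha =>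
    intro y
    obtain ⟨z, hz⟩ := ha y
    exact ⟨r • z, by rw [smul_assoc, map_smul, LinearMap.smul_apply, hz, map_smul]⟩

variable (n F R)

/-- The `RG`-submodule `I(c) = {x ∈ I | f(x, I) ⊆ ℓ ^ c R}` of `I`. -/
def lattice (ℓ c : ℕ) : Submodule R[GL (Fin n) F] (steinberg n F R) where
  carrier := {x | ∀ y, steinbergForm n F R x y ∈ Ideal.span {(ℓ : R) ^ c}}
  zero_mem' := fun y => by simp
  add_mem' := by
    intro x x' hx hx' y
    rw [map_add, LinearMap.add_apply]
    exact Ideal.add_mem _ (hx y) (hx' y)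
  smul_mem' := by
    intro a x hx y
    obtain ⟨z, hz⟩ := steinbergForm_smul a x y
    rw [hz]
    exact hx z

end Lattice

section Reduction

variable (R G : Type*) [CommRing R] [Group G] (ℓ : ℕ)
  (M : Type*) [AddCommGroup M] [Module R M] [Module R[G] M] [IsScalarTower R R[G] M]

/-- The `R`-linear action of an element `g` of `G` on `M / ℓ M`. -/
def reductionAux (g : G) : (M ⧸ (Ideal.span {(ℓ : R)} • (⊤ : Submodule R M))) →ₗ[R]
    (M ⧸ (Ideal.span {(ℓ : R)} • (⊤ : Submodule R M))) :=
  Submodule.mapQ (Ideal.span {(ℓ : R)} • (⊤ : Submodule R M))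
    (Ideal.span {(ℓ : R)} • (⊤ : Submodule R M))
    (Representation.ofModule' (k := R) (G := G) M g)
    (Submodule.smul_top_le_comap_smul_top _ _)

theorem reductionAux_mk (g : G) (m : M) :
    reductionAux R G ℓ M g (Submodule.Quotient.mk m) =
      Submodule.Quotient.mk (MonoidAlgebra.of R G g • m) :=
  rfl

/-- The action of `G` on `M / ℓ M` over `K = R / ℓ R`, for an `RG`-module `M`. -/
def reductionRep : Representation (R ⧸ Ideal.span {(ℓ : R)}) G
    (M ⧸ (Ideal.span {(ℓ : R)} • (⊤ : Submodule R M))) where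
  toFun g := LinearMap.extendScalarsOfSurjective (S := R ⧸ Ideal.span {(ℓ : R)})
    Ideal.Quotient.mk_surjective (reductionAux R G ℓ M g)
  map_one' := by
    refine LinearMap.ext fun x => ?_
    obtain ⟨m, rfl⟩ := Submodule.Quotient.mk_surjective _ x
    change reductionAux R G ℓ M 1 (Submodule.Quotient.mk m) = Submodule.Quotient.mk m
    rw [reductionAux_mk, map_one, one_smul]
  map_mul' g h := by
    refine LinearMap.ext fun x => ?_
    obtain ⟨m, rfl⟩ := Submodule.Quotient.mk_surjective _ x
    change reductionAux R G ℓ M (g * h) (Submodule.Quotient.mk m) =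
      reductionAux R G ℓ M g (reductionAux R G ℓ M h (Submodule.Quotient.mk m))
    rw [reductionAux_mk, reductionAux_mk, reductionAux_mk, map_mul, mul_smul]

/-- The `KG`-module `M / ℓ M`, the reduction modulo `ℓ` of the `RG`-module `M`,
where `K = R / ℓ R`. -/
abbrev Reduction : Type _ := (reductionRep R G ℓ M).asModule

/-- `G` acts on `M / ℓ M` by acting on representatives. -/
theorem reductionRep_mk (g : G) (m : M) :
    reductionRep R G ℓ M g (Submodule.Quotient.mk m) =
      Submodule.Quotient.mk (MonoidAlgebra.of R G g • m) := by
  rfl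

end Reduction

end SteinbergLattice

end

namespace SteinbergLattice

/-! ### Bruhat decomposition by Gaussian elimination. -/

section Bruhat

variable {n : ℕ} {F : Type*} [Field F]

/-! Let U be the group of upper unitriangular matrices. The lattice I is spanned by the vectors u𝐞
with u in U (`eq_sum_bigCell`), so for a linear character χ of U the operator `hatChar χ` maps I
into the multiples of one vector v_χ = `charVec χ` (`hatChar_smul_eq`). A multiple r v_χ lies in
I(c) exactly when ℓ^c divides r f(v_χ, 𝐞), and f(v_χ, 𝐞) is the sum over σ of the sums of χ over U ∩
σBσ⁻¹. For P containing B, let χ_P be nontrivial exactly on the simple root subgroups inside the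
diagonal blocks of P. Orthogonality leaves only those σ for which χ_P is trivial on U ∩ σBσ⁻¹, and
the orders of these groups add up to [G:P] by the Bruhat count of G/P (`index_eq_sum_patt`). So
f(v_{χ_P}, 𝐞) = [G:P]; this is 1 for P = G, and the trivial character gives [G:B].

Non-isomorphism: let ℓ^a be the exact power dividing [G:P], let w reverse the order of the blocks of
P, and let t be the product of `hatChar χ_G`, w and `hatChar χ_P` (`testElement`). If c < a, then tI
consists of multiples of v_{χ_G} lying in I(a), hence in ℓ^a R v_{χ_G}, which is inside ℓI(c); so t
kills T^c. If a ≤ h, then ℓ^(h-a) v_{χ_P} lies in I(h), and its image under t pairs with 𝐞 to a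
number exactly divisible by ℓ^h (`exists_isUnit_mul_index`), while ℓI(h) pairs into ℓ^(h+1)R; so t
does not kill T^h.

Stabilization: if x in I(i+1) has a unit coefficient k on the big cell, then a translate of x,
summed over U, is k v_1, which forces ℓ^(i+1) to divide [G:B]. For i ≥ b this is impossible, so
I(i+1) lies in ℓI and multiplication by ℓ maps I(i) isomorphically onto I(i+1). -/

theorem permGL_apply (σ : Equiv.Perm (Fin n)) (i j : Fin n) :
    (permGL n F σ : Matrix (Fin n) (Fin n) F) i j = if i = σ j then 1 else 0 := by
  change (σ⁻¹).permMatrix F i j = _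
  have : (j = σ⁻¹ i) = (i = σ j) := by
    rw [eq_iff_iff, Equiv.Perm.eq_inv_iff_eq, eq_comm]
  simp only [← this, Equiv.Perm.permMatrix, PEquiv.toMatrix_apply]
  simp [eq_comm]

theorem permGL_mul_apply (σ : Equiv.Perm (Fin n)) (g : GL (Fin n) F) (i j : Fin n) :
    (permGL n F σ * g : GL (Fin n) F) i j = g (σ⁻¹ i) j := by
  have (x : Fin n) : (i = σ x) = (x = σ⁻¹ i) := by
    rw [eq_iff_iff, Equiv.Perm.eq_inv_iff_eq, eq_comm]
  simp only [Units.val_mul, Matrix.mul_apply, permGL_apply, this]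
  simp

theorem mul_permGL_apply (σ : Equiv.Perm (Fin n)) (g : GL (Fin n) F) (i j : Fin n) :
    (g * permGL n F σ : GL (Fin n) F) i j = g i (σ j) := by
  simp [Units.val_mul, Matrix.mul_apply, permGL_apply]

theorem mem_borel {g : GL (Fin n) F} : g ∈ borel n F ↔ ∀ i j : Fin n, j < i → g i j = 0 :=
  Iff.rfl

theorem borel_diag_ne_zero {g : GL (Fin n) F} (hg : g ∈ borel n F) (i : Fin n) : g i i ≠ 0 := by
  have h : (g : Matrix (Fin n) (Fin n) F).det ≠ 0 :=
    ((Matrix.isUnit_iff_isUnit_det _).1 g.isUnit).ne_zero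
  rw [Matrix.det_of_isUpperTriangular fun i j h => hg i j h] at h
  exact Finset.prod_ne_zero_iff.1 h i (Finset.mem_univ i)

/-- An upper triangular matrix with nonzero diagonal entries, as an element of `GL_n(F)`. -/
noncomputable def ofUpper (M : Fin n → Fin n → F) (h : ∀ i j, j < i → M i j = 0)
    (hd : ∀ i, M i i ≠ 0) : GL (Fin n) F :=
  Matrix.GeneralLinearGroup.mkOfDetNeZero (Matrix.of M) <| by
    rw [Matrix.det_of_isUpperTriangular (M := Matrix.of M) fun i j hij => h i j hij]
    exact Finset.prod_ne_zero_iff.2 fun i _ => hd i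

@[simp]
theorem ofUpper_apply (M : Fin n → Fin n → F) (h : ∀ i j, j < i → M i j = 0)
    (hd : ∀ i, M i i ≠ 0) (i j : Fin n) : ofUpper M h hd i j = M i j :=
  rfl

variable (n F) in
/-- The group of upper unitriangular matrices. -/
def unip : Subgroup (GL (Fin n) F) where
  carrier := {g | g ∈ borel n F ∧ ∀ i, g i i = 1}
  one_mem' := ⟨one_mem _, fun i => by simp⟩
  mul_mem' := by
    rintro a b ⟨ha, ha'⟩ ⟨hb, hb'⟩
    refine ⟨mul_mem ha hb, fun i => ?_⟩
    rw [Units.val_mul, Matrix.mul_apply, Finset.sum_eq_single i, ha', hb', one_mul]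
    · intro j _ hj
      rcases hj.lt_or_gt with h | h
      · rw [ha _ _ h, zero_mul]
      · rw [hb _ _ h, mul_zero]
    · simp
  inv_mem' := by
    rintro a ⟨ha, ha'⟩
    refine ⟨inv_mem ha, fun i => ?_⟩
    have h : (a * a⁻¹ : GL (Fin n) F) i i = 1 := by simp
    rw [Units.val_mul, Matrix.mul_apply, Finset.sum_eq_single i, ha', one_mul] at h
    · exact h
    · intro j _ hj
      rcases hj.lt_or_gt with h | h
      · rw [ha _ _ h, zero_mul]
      · rw [(inv_mem ha : a⁻¹ ∈ borel n F) _ _ h, mul_zero]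
    · simp

theorem unip_le_borel : unip n F ≤ borel n F := fun _ h => h.1

theorem ofUpper_mem_borel (M : Fin n → Fin n → F) (h : ∀ i j, j < i → M i j = 0)
    (hd : ∀ i, M i i ≠ 0) : ofUpper M h hd ∈ borel n F := h

theorem exists_pivot (g : GL (Fin n) F) (k : Fin n) :
    ∃ a, g a k ≠ 0 ∧ ∀ r, a < r → g r k = 0 := by
  classical
  have hne : (Finset.univ.filter fun r => g r k ≠ 0).Nonempty := by
    by_contra h
    rw [Finset.not_nonempty_iff_eq_empty, Finset.filter_eq_empty_iff] at h
    simp only [Finset.mem_univ, not_not, forall_const] at h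
    exact ((Matrix.isUnit_iff_isUnit_det _).1 g.isUnit).ne_zero
      (Matrix.det_eq_zero_of_column_eq_zero k fun i => h (x := i))
  refine ⟨Finset.max' _ hne, (Finset.mem_filter.1 (Finset.max'_mem _ hne)).2, fun r hr => ?_⟩
  by_contra h
  exact absurd (Finset.le_max' _ r (Finset.mem_filter.2 ⟨Finset.mem_univ r, h⟩)) (not_le.2 hr)

/-- Gaussian elimination at the pivot `(a, k)`. -/
theorem exists_clear_pivot (g : GL (Fin n) F) (a k : Fin n) (hak : g a k ≠ 0)
    (hcol : ∀ r, a < r → g r k = 0) (hrow : ∀ m, m < k → g a m = 0) :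
    ∃ u ∈ unip n F, ∃ b ∈ borel n F, ∀ r m, (u * g * b : GL (Fin n) F) r m =
      g r m - g r k * g a m / g a k + (if r = a then 1 else 0) * (if m = k then 1 else 0) := by
  -- The matrix `L` = 1 + lv ⊗ e_a clears column `k` outside the pivot; `T` = 1 + e_k ⊗ rv clears
  -- row `a` and scales the pivot to 1. They are upper triangular because of `hcol` and `hrow`.
  let lv : Fin n → F := fun r => (if r = a then 1 else 0) - g r k / g a k
  let rv : Fin n → F := fun m => ((if m = k then 1 else 0) - g a m) / g a k
  let L : Fin n → Fin n → F := fun r c =>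
    (if r = c then 1 else 0) + lv r * (if c = a then 1 else 0)
  let T : Fin n → Fin n → F := fun r c =>
    (if r = c then 1 else 0) + (if r = k then 1 else 0) * rv c
  have hL : ∀ i j, j < i → L i j = 0 := by
    intro i j h
    by_cases hj : j = a
    · subst hj
      simp [L, lv, h.ne', hcol i h]
    · simp [L, h.ne', hj]
  have hLd : ∀ i, L i i = 1 := by
    intro i
    by_cases hj : i = a
    · subst hj
      simp [L, lv, div_self hak]
    · simp [L, hj]
  have hT : ∀ i j, j < i → T i j = 0 := by
    intro i j h
    by_cases hj : i = k
    · subst hj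
      simp [T, rv, h.ne', h.ne, hrow j h]
    · simp [T, h.ne', hj]
  have hTd : ∀ i, T i i ≠ 0 := by
    intro i
    by_cases hj : i = k
    · subst hj
      have : T i i = (g i i ^ 0) / g a i := by
        simp only [T, rv, if_true, one_mul]
        field_simp
        ring
      rw [this]
      simp [hak]
    · simp [T, hj]
  refine ⟨ofUpper L hL (fun i => by simp [hLd]), ⟨hL, hLd⟩, ofUpper T hT hTd, hT, fun r m => ?_⟩
  have h1 : ∀ m, (ofUpper L hL (fun i => by simp [hLd]) * g : GL (Fin n) F) r m =
      g r m + lv r * g a m := by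
    intro m
    simp only [Units.val_mul, Matrix.mul_apply, ofUpper_apply, L]
    simp [add_mul, Finset.sum_add_distrib]
  rw [Units.val_mul, Matrix.mul_apply]
  simp only [h1, ofUpper_apply, T]
  simp only [mul_add, Finset.sum_add_distrib, mul_ite, mul_one, mul_zero, ite_mul, one_mul,
    zero_mul, Finset.sum_ite_eq', Finset.mem_univ, if_true]
  simp only [lv, rv]
  field_simp
  split_ifs <;> ring

/-- The Bruhat decomposition `G = U W B`. -/
theorem bruhat (g : GL (Fin n) F) :
    ∃ u ∈ unip n F, ∃ σ : Equiv.Perm (Fin n), ∃ b ∈ borel n F, g = u * permGL n F σ * b := by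
  -- Invariant: the first `k` columns and the rows of their pivots already look like a permutation
  -- matrix. The row condition keeps later pivots out of used rows.
  have key : ∀ k : ℕ, k ≤ n → ∃ u ∈ unip n F, ∃ b ∈ borel n F, ∃ p : Fin n → Fin n,
      ∀ j : Fin n, (j : ℕ) < k →
        (∀ r, (u * g * b : GL (Fin n) F) r j = if r = p j then 1 else 0) ∧
        (∀ m, (u * g * b : GL (Fin n) F) (p j) m = if m = j then 1 else 0) := by
    intro k
    induction k with
    | zero => exact fun _ => ⟨1, one_mem _, 1, one_mem _, id, fun j h => absurd h (by simp)⟩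
    | succ k ih =>
      intro hk
      obtain ⟨u, hu, b, hb, p, hp⟩ := ih (by omega)
      set g' := u * g * b
      let k' : Fin n := ⟨k, hk⟩
      obtain ⟨a, ha, hcol⟩ := exists_pivot g' k'
      have hpa : ∀ j : Fin n, (j : ℕ) < k → p j ≠ a ∧ g' (p j) k' = 0 := by
        intro j hj
        have h0 : g' (p j) k' = 0 := by
          rw [(hp j hj).2, if_neg]
          rintro rfl
          exact lt_irrefl _ hj
        exact ⟨fun h => ha (h ▸ h0), h0⟩
      have hrow : ∀ m, m < k' → g' a m = 0 := fun m hm => by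
        rw [(hp m hm).1, if_neg (hpa m hm).1.symm]
      obtain ⟨v, hv, c, hc, hvc⟩ := exists_clear_pivot g' a k' ha hcol hrow
      refine ⟨v * u, mul_mem hv hu, b * c, mul_mem hb hc, Function.update p k' a, fun j hj => ?_⟩
      have hassoc : v * u * g * (b * c) = v * g' * c := by simp only [g', mul_assoc]
      rw [hassoc]
      rcases Nat.lt_succ_iff_lt_or_eq.1 hj with hj | hj
      · have hjk : j ≠ k' := by
          rintro rfl
          exact lt_irrefl _ hj
        rw [Function.update_of_ne hjk]
        refine ⟨fun r => ?_, fun m => ?_⟩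
        · rw [hvc, hrow j hj, if_neg hjk, ← (hp j hj).1]
          simp
        · rw [hvc, (hpa j hj).2, if_neg (hpa j hj).1, ← (hp j hj).2]
          simp
      · obtain rfl : j = k' := Fin.ext hj
        rw [Function.update_self]
        refine ⟨fun r => ?_, fun m => ?_⟩
        · rw [hvc]
          field_simp
          simp
        · rw [hvc]
          field_simp
          simp
  obtain ⟨u, hu, b, hb, p, hp⟩ := key n le_rfl
  have hinj : Function.Injective p := by
    intro i j h
    have h1 := (hp i i.2).2 j
    rw [h, (hp j j.2).1 (p j), if_pos rfl] at h1
    by_contra hij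
    rw [if_neg (Ne.symm hij)] at h1
    exact one_ne_zero h1
  let σ : Equiv.Perm (Fin n) := Equiv.ofBijective p (Finite.injective_iff_bijective.1 hinj)
  have hσ : u * g * b = permGL n F σ := by
    ext i j
    rw [(hp j j.2).1 i, permGL_apply]
    rfl
  refine ⟨u⁻¹, inv_mem hu, σ, b⁻¹, inv_mem hb, ?_⟩
  rw [← hσ]
  group

theorem perm_apply_inv {α : Type*} (σ : Equiv.Perm α) (a : α) : σ (σ⁻¹ a) = a :=
  Equiv.apply_symm_apply σ a

theorem perm_inv_apply {α : Type*} (σ : Equiv.Perm α) (a : α) : σ⁻¹ (σ a) = a :=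
  Equiv.symm_apply_apply σ a

/-- The values of any two permutations have the same sum, so no inequality can be strict. -/
theorem perm_eq_of_le {σ τ : Equiv.Perm (Fin n)} (h : ∀ k, σ k ≤ τ k) : σ = τ := by
  have hsum : ∑ k, ((σ k : Fin n) : ℕ) = ∑ k, ((τ k : Fin n) : ℕ) := by
    rw [Equiv.sum_comp σ (fun k : Fin n => (k : ℕ)), Equiv.sum_comp τ (fun k : Fin n => (k : ℕ))]
  have := (Finset.sum_eq_sum_iff_of_le fun k _ => Fin.le_def.1 (h k)).1 hsum
  exact Equiv.ext fun k => Fin.ext (this k (Finset.mem_univ k))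

theorem conj_permGL_apply (σ τ : Equiv.Perm (Fin n)) (g : GL (Fin n) F) (i j : Fin n) :
    ((permGL n F σ)⁻¹ * g * permGL n F τ : GL (Fin n) F) i j = g (σ i) (τ j) := by
  rw [← map_inv, mul_permGL_apply, permGL_mul_apply, inv_inv]

/-- Uniqueness of the Weyl group element in the Bruhat decomposition. -/
theorem bruhat_unique {σ τ : Equiv.Perm (Fin n)} {u : GL (Fin n) F} (hu : u ∈ borel n F)
    (h : (permGL n F σ)⁻¹ * u * permGL n F τ ∈ borel n F) : σ = τ := by
  refine inv_injective (perm_eq_of_le fun k => not_lt.1 fun hlt => ?_)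
  have := h (σ⁻¹ k) (τ⁻¹ k) hlt
  rw [conj_permGL_apply] at this
  simp only [perm_apply_inv] at this
  exact borel_diag_ne_zero hu k this

end Bruhat

/-! ### The groups U ∩ σBσ⁻¹ and their orders. -/

section Pattern

variable {n : ℕ} {F : Type*} [Field F]

variable (F) in
/-- The pattern group `U ∩ σ B σ⁻¹`. -/
def patt (σ : Equiv.Perm (Fin n)) : Subgroup (GL (Fin n) F) :=
  unip n F ⊓ (borel n F).comap (MulAut.conj (permGL n F σ)⁻¹).toMonoidHom

theorem mem_patt {σ : Equiv.Perm (Fin n)} {u : GL (Fin n) F} :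
    u ∈ patt F σ ↔ u ∈ unip n F ∧ (permGL n F σ)⁻¹ * u * permGL n F σ ∈ borel n F := by
  simp [patt, Subgroup.mem_inf, Subgroup.mem_comap]

theorem mem_patt_iff {σ : Equiv.Perm (Fin n)} {u : GL (Fin n) F} :
    u ∈ patt F σ ↔ u ∈ unip n F ∧ ∀ i j, σ⁻¹ j < σ⁻¹ i → u i j = 0 := by
  rw [mem_patt]
  refine and_congr_right fun _ => ⟨fun h i j hij => ?_, fun h i j hij => ?_⟩
  · have := h _ _ hij
    rwa [conj_permGL_apply, perm_apply_inv, perm_apply_inv] at this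
  · rw [conj_permGL_apply]
    exact h _ _ (by simpa using hij)

/-- The positions above the diagonal that are free in `patt F σ`. -/
def pairs (σ : Equiv.Perm (Fin n)) : Finset (Fin n × Fin n) :=
  {p | p.1 < p.2 ∧ σ⁻¹ p.1 < σ⁻¹ p.2}

theorem mem_pairs {σ : Equiv.Perm (Fin n)} {p : Fin n × Fin n} :
    p ∈ pairs σ ↔ p.1 < p.2 ∧ σ⁻¹ p.1 < σ⁻¹ p.2 := by
  simp [pairs]

/-- An element of the pattern group is determined by its free entries. -/
noncomputable def pattEquiv (σ : Equiv.Perm (Fin n)) : patt F σ ≃ (pairs σ → F) where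
  toFun u p := (u : GL (Fin n) F) p.1.1 p.1.2
  invFun c := ⟨ofUpper
      (fun i j => if h : (i, j) ∈ pairs σ then c ⟨(i, j), h⟩ else if i = j then 1 else 0)
      (fun i j h => by
        rw [dif_neg fun h' => (mem_pairs.1 h').1.not_gt h, if_neg h.ne'])
      (fun i => by
        rw [dif_neg fun h' => lt_irrefl _ (mem_pairs.1 h').1, if_pos rfl]
        exact one_ne_zero), by
    refine mem_patt_iff.2 ⟨⟨ofUpper_mem_borel _ _ _, fun i => ?_⟩, fun i j hij => ?_⟩
    · rw [ofUpper_apply, dif_neg fun h' => lt_irrefl _ (mem_pairs.1 h').1, if_pos rfl]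
    · rw [ofUpper_apply, dif_neg fun h' => (mem_pairs.1 h').2.not_gt hij, if_neg]
      rintro rfl
      exact lt_irrefl _ hij⟩
  left_inv u := by
    obtain ⟨u, hu⟩ := u
    obtain ⟨hu1, hu2⟩ := mem_patt_iff.1 hu
    refine Subtype.ext (Units.ext (Matrix.ext fun i j => ?_))
    rw [ofUpper_apply]
    split_ifs with h h'
    · rfl
    · rw [h', hu1.2]
    · rcases lt_or_gt_of_ne h' with hlt | hgt
      · symm
        apply hu2
        refine lt_of_le_of_ne (not_lt.1 fun h2 => h (mem_pairs.2 ⟨hlt, h2⟩)) ?_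
        intro h3
        exact h' (σ⁻¹.injective h3).symm
      · exact (hu1.1 _ _ hgt).symm
  right_inv c := by
    funext p
    obtain ⟨p, hp⟩ := p
    exact dif_pos hp

theorem card_patt [Finite F] (σ : Equiv.Perm (Fin n)) :
    Nat.card (patt F σ) = Nat.card F ^ (pairs σ).card := by
  have := Fintype.ofFinite F
  rw [Nat.card_congr (pattEquiv σ), Nat.card_fun, Nat.card_eq_finsetCard]

theorem patt_one : patt F (1 : Equiv.Perm (Fin n)) = unip n F := by
  ext u
  rw [mem_patt_iff]
  exact ⟨fun h => h.1, fun h => ⟨h, fun i j hij => h.1 i j hij⟩⟩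

theorem card_patt_inv [Finite F] (σ : Equiv.Perm (Fin n)) :
    Nat.card (patt F σ⁻¹) = Nat.card (patt F σ) := by
  rw [card_patt, card_patt]
  congr 1
  refine Finset.card_bij' (fun p _ => (σ p.1, σ p.2)) (fun p _ => (σ⁻¹ p.1, σ⁻¹ p.2))
    ?_ ?_ ?_ ?_
  all_goals simp +contextual [mem_pairs]

/-- Up to the reflection (i, j) ↦ (rev j, rev i), the free positions of w₀τ are the positions above
the diagonal that are not free for τ. -/
theorem card_patt_mul_card_patt_rev [Finite F] (τ : Equiv.Perm (Fin n)) :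
    Nat.card (patt F (Fin.revPerm * τ)) * Nat.card (patt F τ) = Nat.card (unip n F) := by
  rw [← patt_one, card_patt, card_patt, card_patt, ← pow_add]
  congr 1
  have h1 : (pairs (Fin.revPerm * τ)).card =
      (Finset.univ.filter fun p : Fin n × Fin n => p.1 < p.2 ∧ τ⁻¹ p.2 < τ⁻¹ p.1).card := by
    refine Finset.card_bij' (fun p _ => (Fin.rev p.2, Fin.rev p.1))
      (fun p _ => (Fin.rev p.2, Fin.rev p.1)) ?_ ?_ ?_ ?_
    · rintro ⟨a, b⟩ h
      have := mem_pairs.1 h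
      simpa [mul_inv_rev, Fin.revPerm] using this
    · rintro ⟨a, b⟩ h
      simp only [Finset.mem_filter, Finset.mem_univ, true_and] at h
      refine mem_pairs.2 ?_
      simpa [mul_inv_rev, Fin.revPerm] using h
    · simp
    · simp
  rw [h1, ← Finset.card_union_of_disjoint]
  · congr 1
    ext ⟨a, b⟩
    simp only [Finset.mem_union, Finset.mem_filter, Finset.mem_univ, true_and, mem_pairs, inv_one,
      Equiv.Perm.coe_one, id_eq, and_self]
    constructor
    · rintro (h | h) <;> exact h.1
    · intro h
      rcases lt_trichotomy (τ⁻¹ a) (τ⁻¹ b) with h' | h' | h'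
      · exact Or.inr ⟨h, h'⟩
      · exact absurd (τ⁻¹.injective h') h.ne
      · exact Or.inl ⟨h, h'⟩
  · rw [Finset.disjoint_left]
    rintro ⟨a, b⟩ h h'
    exact lt_asymm (Finset.mem_filter.1 h).2.2 (mem_pairs.1 h').2

end Pattern

/-! ### Root subgroups and transpositions. -/

section Transvections

variable {n : ℕ} {F : Type*} [Field F]

/-- The elementary matrix `1 + t E_{ij}` as an element of `GL_n(F)`. -/
def transvGL (i j : Fin n) (h : i ≠ j) (t : F) : GL (Fin n) F where
  val := Matrix.transvection i j t
  inv := Matrix.transvection i j (-t)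
  val_inv := by simp [Matrix.transvection_mul_transvection_same _ _ h]
  inv_val := by simp [Matrix.transvection_mul_transvection_same _ _ h]

theorem transvGL_apply (i j : Fin n) (h : i ≠ j) (t : F) (a b : Fin n) :
    transvGL i j h t a b = (if a = b then 1 else 0) + (if a = i ∧ b = j then t else 0) := by
  simp [transvGL, Matrix.transvection, Matrix.one_apply, Matrix.single_apply, eq_comm]

theorem mul_transvGL_apply (g : GL (Fin n) F) (i j : Fin n) (h : i ≠ j) (t : F) (a b : Fin n) :
    (g * transvGL i j h t : GL (Fin n) F) a b =
      g a b + if b = j then g a i * t else 0 := by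
  simp only [Units.val_mul, Matrix.mul_apply, transvGL_apply]
  by_cases hb : b = j <;> simp [hb, mul_add, Finset.sum_add_distrib]

theorem transvGL_mem_unip {i j : Fin n} (h : i < j) (t : F) : transvGL i j h.ne t ∈ unip n F := by
  refine ⟨fun a b hab => ?_, fun a => ?_⟩
  · rw [transvGL_apply, if_neg hab.ne', if_neg, add_zero]
    rintro ⟨rfl, rfl⟩
    exact lt_asymm h hab
  · rw [transvGL_apply, if_pos rfl, if_neg, add_zero]
    rintro ⟨rfl, rfl⟩
    exact h.ne rfl

theorem permGL_mul_transvGL (σ : Equiv.Perm (Fin n)) (i j : Fin n) (h : i ≠ j) (t : F) :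
    permGL n F σ * transvGL i j h t =
      transvGL (σ i) (σ j) (σ.injective.ne h) t * permGL n F σ := by
  ext a b
  rw [permGL_mul_apply, mul_permGL_apply, transvGL_apply, transvGL_apply]
  have h1 (x : Fin n) : (σ⁻¹ a = x) = (a = σ x) := by
    rw [eq_iff_iff, Equiv.Perm.inv_eq_iff_eq]
  simp [h1, -Equiv.Perm.coe_inv]

theorem transvGL_commutator {i j k : Fin n} (hij : i ≠ j) (hjk : j ≠ k) (hik : i ≠ k) (s t : F) :
    transvGL i k hik (s * t) = transvGL i j hij s * transvGL j k hjk t *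
      (transvGL i j hij s)⁻¹ * (transvGL j k hjk t)⁻¹ := by
  rw [eq_mul_inv_iff_mul_eq, eq_mul_inv_iff_mul_eq]
  ext a b
  simp only [mul_transvGL_apply, transvGL_apply]
  by_cases hbj : b = j
  · subst hbj
    simp [hjk, hik]
  · by_cases hbk : b = k
    · subst hbk
      by_cases hai : a = i
      · subst hai
        simp [hij, hjk, hbj, hik]
      · simp [hai, hbj]
    · simp [hbj, hbk]

theorem permGL_swap_mem_of_transvGL_mem {P : Subgroup (GL (Fin n) F)} (hP : borel n F ≤ P)
    {i j : Fin n} (h : i ≠ j) (hij : ∀ t, transvGL i j h t ∈ P)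
    (hji : ∀ t, transvGL j i h.symm t ∈ P) : permGL n F (Equiv.swap i j) ∈ P := by
  -- `N` is the usual monomial representative of the reflection; multiplying by the transposition
  -- leaves a diagonal matrix with entries ±1.
  set N := transvGL i j h (1 : F) * transvGL j i h.symm (-1) * transvGL i j h 1
  have hN : N ∈ P := mul_mem (mul_mem (hij _) (hji _)) (hij _)
  have hB : N * permGL n F (Equiv.swap i j) ∈ borel n F := by
    intro a b hba
    have hne := hba.ne'
    rw [mul_permGL_apply]
    simp only [N, mul_transvGL_apply, transvGL_apply]
    rcases eq_or_ne b i with rfl | hbi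
    · simp only [Equiv.swap_apply_left]
      by_cases haj : a = j <;> simp [haj, hne, h, h.symm]
    · rcases eq_or_ne b j with rfl | hbj
      · simp only [Equiv.swap_apply_right]
        by_cases hai : a = i <;> simp [hai, hne, h]
      · simp [Equiv.swap_apply_of_ne_of_ne hbi hbj, hbi, hbj, hne]
  simpa using mul_mem (inv_mem hN) (hP hB)

end Transvections

/-! ### Subgroups containing B: their blocks and the Bruhat count of G/P. -/

section Parabolic

variable {n : ℕ} {F : Type*} [Field F]

/-- The relation on indices given by the root subgroups contained in `P`. -/
def rootRel (P : Subgroup (GL (Fin n) F)) (a b : Fin n) : Prop :=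
  ∀ (h : a ≠ b) (t : F), transvGL a b h t ∈ P

theorem rootRel_refl (P : Subgroup (GL (Fin n) F)) (a : Fin n) : rootRel P a a :=
  fun h => absurd rfl h

theorem rootRel_trans {P : Subgroup (GL (Fin n) F)} {a b c : Fin n} (hab : rootRel P a b)
    (hbc : rootRel P b c) : rootRel P a c := by
  intro hac t
  rcases eq_or_ne a b with rfl | h1
  · exact hbc hac t
  rcases eq_or_ne b c with rfl | h2
  · exact hab hac t
  have := transvGL_commutator h1 h2 hac 1 t
  rw [one_mul] at this
  rw [this]
  exact mul_mem (mul_mem (mul_mem (hab _ _) (hbc _ _)) (inv_mem (hab _ _))) (inv_mem (hbc _ _))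

theorem rootRel_of_le {P : Subgroup (GL (Fin n) F)} (hP : borel n F ≤ P) {a b : Fin n}
    (h : a ≤ b) : rootRel P a b :=
  fun hne t => hP (unip_le_borel (transvGL_mem_unip (lt_of_le_of_ne h hne) t))

theorem rootRel_perm {P : Subgroup (GL (Fin n) F)} {σ : Equiv.Perm (Fin n)}
    (hσ : permGL n F σ ∈ P) {a b : Fin n} (h : rootRel P a b) : rootRel P (σ a) (σ b) := by
  intro hne t
  have hab : a ≠ b := fun h' => hne (congrArg σ h')
  have := permGL_mul_transvGL σ a b hab t
  rw [← mul_inv_eq_iff_eq_mul] at this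
  rw [← this]
  exact mul_mem (mul_mem hσ (h hab t)) (inv_mem hσ)

open Classical in
/-- The number of indices not above `a` for `rootRel P`; its fibres are the blocks of `P`. -/
noncomputable def block (P : Subgroup (GL (Fin n) F)) (a : Fin n) : ℕ :=
  (Finset.univ.filter fun c => ¬ rootRel P a c).card

/-- `rootRel P` is a preorder, and it is total because P contains B; in a total preorder the count
in `block` determines the order. -/
theorem rootRel_iff {P : Subgroup (GL (Fin n) F)} (hP : borel n F ≤ P) {a b : Fin n} :
    rootRel P a b ↔ block P a ≤ block P b := by
  classical
  constructor
  · intro h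
    refine Finset.card_le_card fun c hc => ?_
    simp only [Finset.mem_filter, Finset.mem_univ, true_and] at hc ⊢
    exact fun h' => hc (rootRel_trans h h')
  · intro h
    by_contra hab
    have hba : rootRel P b a := rootRel_of_le hP
      (le_of_not_ge fun h' => hab (rootRel_of_le hP h'))
    refine absurd h (not_le.2 (Finset.card_lt_card (Finset.ssubset_iff_of_subset ?_ |>.2 ?_)))
    · intro c hc
      simp only [Finset.mem_filter, Finset.mem_univ, true_and] at hc ⊢
      exact fun h' => hc (rootRel_trans hba h')
    · exact ⟨b, by simpa using hab, by simpa using rootRel_refl P b⟩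

theorem block_monotone {P : Subgroup (GL (Fin n) F)} (hP : borel n F ≤ P) :
    Monotone (block P) := fun _ _ h => (rootRel_iff hP).1 (rootRel_of_le hP h)

theorem block_perm {P : Subgroup (GL (Fin n) F)} {σ : Equiv.Perm (Fin n)}
    (hσ : permGL n F σ ∈ P) (a : Fin n) : block P (σ a) = block P a := by
  classical
  have hσ' : permGL n F σ⁻¹ ∈ P := by
    rw [map_inv]
    exact inv_mem hσ
  symm
  refine Finset.card_bij' (fun c _ => σ c) (fun c _ => σ⁻¹ c) ?_ ?_ ?_ ?_
  · intro c hc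
    simp only [Finset.mem_filter, Finset.mem_univ, true_and] at hc ⊢
    intro h
    have := rootRel_perm hσ' h
    rw [perm_inv_apply, perm_inv_apply] at this
    exact hc this
  · intro c hc
    simp only [Finset.mem_filter, Finset.mem_univ, true_and] at hc ⊢
    intro h
    have := rootRel_perm hσ h
    rw [perm_apply_inv] at this
    exact hc this
  · exact fun c _ => perm_inv_apply σ c
  · exact fun c _ => perm_apply_inv σ c

/-- Indices in one block have both opposite root subgroups in P, hence also their transposition.
Peeling off such transpositions shrinks the support. -/
theorem permGL_mem_of_block {P : Subgroup (GL (Fin n) F)} (hP : borel n F ≤ P)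
    (ρ : Equiv.Perm (Fin n)) (hρ : ∀ a, block P (ρ a) = block P a) : permGL n F ρ ∈ P := by
  induction hk : ρ.support.card using Nat.strong_induction_on generalizing ρ with
  | _ k ih =>
  by_cases h1 : ρ = 1
  · rw [h1, map_one]
    exact one_mem P
  obtain ⟨a, ha⟩ : ∃ a, ρ a ≠ a := by
    by_contra h
    push Not at h
    exact h1 (Equiv.ext h)
  have hswap : permGL n F (Equiv.swap a (ρ a)) ∈ P :=
    permGL_swap_mem_of_transvGL_mem hP ha.symm
      ((rootRel_iff hP).2 (hρ a).ge ha.symm) ((rootRel_iff hP).2 (hρ a).le ha)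
  have hmul : permGL n F (Equiv.swap a (ρ a) * ρ) ∈ P := by
    refine ih _ (hk ▸ Equiv.Perm.card_support_swap_mul ha) _ (fun b => ?_) rfl
    rw [Equiv.Perm.mul_apply, ← hρ b]
    generalize ρ b = c
    rcases eq_or_ne c a with rfl | hca
    · rw [Equiv.swap_apply_left, hρ]
    rcases eq_or_ne c (ρ a) with rfl | hca'
    · rw [Equiv.swap_apply_right, hρ]
    · rw [Equiv.swap_apply_of_ne_of_ne hca hca']
  rw [map_mul] at hmul
  exact (P.mul_mem_cancel_left hswap).1 hmul

/-- Elements of P are block upper triangular: in a Bruhat factorization uσv the permutation lies in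
P, so it preserves blocks, and the outer factors are upper triangular. -/
theorem block_le_of_apply_ne_zero {P : Subgroup (GL (Fin n) F)} (hP : borel n F ≤ P)
    {g : GL (Fin n) F} (hg : g ∈ P) {a b : Fin n} (hab : g a b ≠ 0) :
    block P a ≤ block P b := by
  obtain ⟨u, hu, σ, v, hv, rfl⟩ := bruhat g
  have hσ : permGL n F σ ∈ P := by
    rwa [P.mul_mem_cancel_right (hP hv), P.mul_mem_cancel_left (hP (unip_le_borel hu))] at hg
  rw [Units.val_mul, Matrix.mul_apply] at hab
  obtain ⟨c, -, hc⟩ := Finset.exists_ne_zero_of_sum_ne_zero hab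
  rw [mul_permGL_apply] at hc
  have h1 : a ≤ σ c := not_lt.1 fun h => hc (by rw [hu.1 _ _ h, zero_mul])
  have h2 : c ≤ b := not_lt.1 fun h => hc (by rw [hv _ _ h, mul_zero])
  exact (block_monotone hP h1).trans ((block_perm hσ c).le.trans (block_monotone hP h2))

/-- The permutations that are increasing on the fibres of `β`. -/
def IncOn (β : Fin n → ℕ) (τ : Equiv.Perm (Fin n)) : Prop :=
  ∀ a b, a < b → β a = β b → τ a < τ b

/-- The permutations whose inverse is decreasing on the fibres of `β`. -/
def InvDecOn (β : Fin n → ℕ) (σ : Equiv.Perm (Fin n)) : Prop :=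
  ∀ a b, a < b → β a = β b → σ⁻¹ b < σ⁻¹ a

/-- This is the minimal representative of the coset of w modulo fibre-preserving permutations. It is
a stable sort: breaking ties by index gives the increase on fibres. -/
theorem exists_incOn {β : Fin n → ℕ} (hβ : Monotone β) (w : Equiv.Perm (Fin n)) :
    ∃ τ, IncOn β τ ∧ ∀ a, β (τ⁻¹ (w a)) = β a := by
  set κ : Fin n → ℕ := fun a => β (w⁻¹ a)
  have hsort := (Tuple.eq_sort_iff (f := κ) (σ := Tuple.sort κ)).1 rfl
  set τ := Tuple.sort κ
  have hκ : β ∘ (w⁻¹ * τ : Equiv.Perm (Fin n)) = β ∘ (1 : Equiv.Perm (Fin n)) :=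
    Tuple.unique_monotone hsort.1 hβ
  have hκ' (a : Fin n) : κ (τ a) = β a := congrFun hκ a
  refine ⟨τ, fun a b hab h => hsort.2 a b hab ?_, fun a => ?_⟩
  · rw [hκ', hκ', h]
  · rw [← hκ', perm_apply_inv]
    simp only [κ]
    rw [perm_inv_apply]

theorem incOn_unique {β : Fin n → ℕ} (hβ : Monotone β) {τ τ' : Equiv.Perm (Fin n)}
    (hτ : IncOn β τ) (hτ' : IncOn β τ') (h : ∀ k, β (τ⁻¹ k) ≤ β (τ'⁻¹ k)) : τ = τ' := by
  have hsum : ∑ k, β (τ⁻¹ k) = ∑ k, β (τ'⁻¹ k) := by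
    rw [Equiv.sum_comp τ⁻¹ β, Equiv.sum_comp τ'⁻¹ β]
  have heq : ∀ k, β (τ⁻¹ k) = β (τ'⁻¹ k) := fun k =>
    (Finset.sum_eq_sum_iff_of_le fun k _ => h k).1 hsum k (Finset.mem_univ k)
  have key : ∀ ρ : Equiv.Perm (Fin n), IncOn β ρ → (∀ k, β (ρ⁻¹ k) = β (τ⁻¹ k)) →
      ρ = Tuple.sort fun k => β (τ⁻¹ k) := by
    intro ρ hρ hk
    have h1 : ∀ a, β (τ⁻¹ (ρ a)) = β a := fun a => by rw [← hk, perm_inv_apply]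
    refine Tuple.eq_sort_iff.2 ⟨fun a b hab => ?_, fun a b hab h => ?_⟩
    · simpa only [Function.comp_apply, h1] using hβ hab
    · rw [h1, h1] at h
      exact hρ a b hab h
  rw [key τ hτ fun _ => rfl, key τ' hτ' fun k => (heq k).symm]

theorem exists_unip_mul_incOn {P : Subgroup (GL (Fin n) F)} (hP : borel n F ≤ P)
    (g : GL (Fin n) F) : ∃ u ∈ unip n F, ∃ τ, IncOn (block P) τ ∧
      (u * permGL n F τ)⁻¹ * g ∈ P := by
  obtain ⟨u, hu, w, b, hb, rfl⟩ := bruhat g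
  obtain ⟨τ, hτ, hw⟩ := exists_incOn (block_monotone hP) w
  refine ⟨u, hu, τ, hτ, ?_⟩
  have h1 := permGL_mem_of_block hP (τ⁻¹ * w) hw
  have h2 : (u * permGL n F τ)⁻¹ * (u * permGL n F w * b) = permGL n F (τ⁻¹ * w) * b := by
    rw [map_mul, map_inv]
    group
  rw [h2]
  exact mul_mem h1 (hP hb)

theorem incOn_eq_of_mem {P : Subgroup (GL (Fin n) F)} (hP : borel n F ≤ P)
    {τ τ' : Equiv.Perm (Fin n)} (hτ : IncOn (block P) τ) (hτ' : IncOn (block P) τ')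
    {u : GL (Fin n) F} (hu : u ∈ unip n F)
    (h : (permGL n F τ)⁻¹ * u * permGL n F τ' ∈ P) : τ = τ' := by
  refine incOn_unique (block_monotone hP) hτ hτ' fun k => block_le_of_apply_ne_zero hP h ?_
  rw [conj_permGL_apply, perm_apply_inv, perm_apply_inv, hu.2]
  exact one_ne_zero

/-- This computes the stabilizer in U of the coset τP. A nonzero entry of the conjugate below the
diagonal would have to lie inside a block, where τ is increasing, contradicting the triangularity of
u. -/
theorem conj_mem_iff_mem_patt {P : Subgroup (GL (Fin n) F)} (hP : borel n F ≤ P)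
    {τ : Equiv.Perm (Fin n)} (hτ : IncOn (block P) τ) {u : GL (Fin n) F} (hu : u ∈ unip n F) :
    (permGL n F τ)⁻¹ * u * permGL n F τ ∈ P ↔ u ∈ patt F τ := by
  rw [mem_patt, and_iff_right hu]
  refine ⟨fun h i j hji => ?_, fun h => hP h⟩
  by_contra hne
  have h1 := block_le_of_apply_ne_zero hP h hne
  rw [conj_permGL_apply] at hne
  have h2 := hτ j i hji (le_antisymm (block_monotone hP hji.le) h1)
  exact hne (hu.1 _ _ h2)

theorem block_top_eq (a b : Fin n) :
    block (⊤ : Subgroup (GL (Fin n) F)) a = block (⊤ : Subgroup (GL (Fin n) F)) b :=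
  le_antisymm ((rootRel_iff le_top).1 fun _ _ => Subgroup.mem_top _)
    ((rootRel_iff le_top).1 fun _ _ => Subgroup.mem_top _)

theorem invDecOn_block_borel (σ : Equiv.Perm (Fin n)) : InvDecOn (block (borel n F)) σ := by
  intro a b hab h
  have := (rootRel_iff le_rfl).2 h.ge hab.ne' 1 b a hab
  rw [transvGL_apply, if_neg hab.ne', if_pos ⟨rfl, rfl⟩, zero_add] at this
  exact absurd this one_ne_zero

-- The U-orbits on G/P are represented by the minimal coset representatives τ. The orbit of τP has
-- |U| / |U ∩ τBτ⁻¹| points, which is the order of the pattern group of w₀τ, or equally of its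
-- inverse σ; increase of τ on blocks becomes decrease of σ⁻¹.
open Classical in
theorem index_eq_sum_patt [Finite F] {P : Subgroup (GL (Fin n) F)} (hP : borel n F ≤ P) :
    P.index = ∑ σ : Equiv.Perm (Fin n), if InvDecOn (block P) σ then Nat.card (patt F σ) else 0 := by
  let x (τ : Equiv.Perm (Fin n)) : GL (Fin n) F ⧸ P := (permGL n F τ : GL (Fin n) F)
  let S := {τ : Equiv.Perm (Fin n) // IncOn (block P) τ}
  have hbij : Function.Bijective
      (fun p : Σ τ : S, MulAction.orbit (unip n F) (x τ.1) => (p.2 : GL (Fin n) F ⧸ P)) := by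
    constructor
    · rintro ⟨⟨τ, hτ⟩, y, hy⟩ ⟨⟨τ', hτ'⟩, y', hy'⟩ h
      dsimp only at h
      subst h
      obtain ⟨u, rfl⟩ := hy
      obtain ⟨v, hv⟩ := hy'
      have h1 : ((v * permGL n F τ' : GL (Fin n) F) : GL (Fin n) F ⧸ P) =
          ((u * permGL n F τ : GL (Fin n) F) : GL (Fin n) F ⧸ P) := hv
      rw [eq_comm, QuotientGroup.eq] at h1
      have : τ = τ' := by
        refine incOn_eq_of_mem hP hτ hτ' (u := u⁻¹ * v) (mul_mem (inv_mem u.2) v.2) ?_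
        rwa [mul_inv_rev, mul_assoc, ← mul_assoc _ (v : GL (Fin n) F), ← mul_assoc] at h1
      subst this
      rfl
    · intro y
      obtain ⟨g, rfl⟩ := QuotientGroup.mk_surjective y
      obtain ⟨u, hu, τ, hτ, h⟩ := exists_unip_mul_incOn hP g
      exact ⟨⟨⟨τ, hτ⟩, _, ⟨⟨u, hu⟩, QuotientGroup.eq.2 h⟩⟩, rfl⟩
  have horb : ∀ τ : S, Nat.card (MulAction.orbit (unip n F) (x τ.1)) =
      Nat.card (patt F (Fin.revPerm * τ.1)⁻¹) := by
    rintro ⟨τ, hτ⟩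
    have h1 : Nat.card (MulAction.stabilizer (unip n F) (x τ)) = Nat.card (patt F τ) := by
      refine Nat.card_congr ⟨fun u => ⟨u.1, ?_⟩, fun u => ⟨⟨u, (mem_patt.1 u.2).1⟩, ?_⟩,
        fun _ => rfl, fun _ => rfl⟩
      · have h := u.2
        rw [← conj_mem_iff_mem_patt hP hτ u.1.2]
        have h' : ((u.1 * permGL n F τ : GL (Fin n) F) : GL (Fin n) F ⧸ P) =
          (permGL n F τ : GL (Fin n) F) := h
        rw [eq_comm, QuotientGroup.eq, ← mul_assoc] at h'
        exact h'
      · have h := (conj_mem_iff_mem_patt hP hτ (mem_patt.1 u.2).1).2 u.2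
        rw [mul_assoc] at h
        exact (QuotientGroup.eq.2 h).symm
    have h2 := Nat.card_congr (MulAction.orbitProdStabilizerEquivGroup (unip n F) (x τ))
    rw [Nat.card_prod, h1, ← card_patt_mul_card_patt_rev τ] at h2
    rw [card_patt_inv]
    exact Nat.eq_of_mul_eq_mul_right Nat.card_pos h2
  have : Fintype S := Fintype.ofFinite S
  rw [Subgroup.index, ← Nat.card_congr (Equiv.ofBijective _ hbij), Nat.card_sigma,
    Finset.sum_congr rfl fun τ _ => horb τ, ← Finset.sum_filter]
  refine Finset.sum_bij' (fun τ _ => (Fin.revPerm * τ.1)⁻¹)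
    (fun σ hσ => ⟨(σ * Fin.revPerm)⁻¹, ?_⟩) ?_ ?_ ?_ ?_ ?_
  · intro a b hab hβ
    have := (Finset.mem_filter.1 hσ).2 a b hab hβ
    simpa [mul_inv_rev, Fin.revPerm] using this
  · rintro ⟨τ, hτ⟩ -
    refine Finset.mem_filter.2 ⟨Finset.mem_univ _, fun a b hab hβ => ?_⟩
    have := hτ a b hab hβ
    simpa [Fin.revPerm] using this
  · intro σ hσ
    exact Finset.mem_univ _
  · rintro ⟨τ, hτ⟩ -
    ext a
    simp [Fin.revPerm]
  · intro σ hσ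
    ext a
    simp [Fin.revPerm]
  · intro τ _
    rfl

end Parabolic

/-! ### Coefficients of 𝐞 and the line relations. -/

section Coefficients

variable {n : ℕ} {F : Type*} [Field F] {R : Type*} [CommRing R]

-- The q + 1 cosets counted are those of B in gQ, where Q is the minimal parabolic of the adjacent
-- pair. One of them is B itself precisely when g lies in Q, and none is otherwise.
open Classical in
theorem borel_line_count [Fintype F] {a b : Fin n} (hab : (b : ℕ) = a + 1) (hne : a ≠ b)
    (g : GL (Fin n) F) :
    (if g ∈ borel n F then (1 : R) else 0) +
      ∑ t : F, (if g * transvGL a b hne t * permGL n F (Equiv.swap a b) ∈ borel n F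
        then (1 : R) else 0) =
    if (∀ i j, j < i → ¬ (i = b ∧ j = a) → g i j = 0) then 1 else 0 := by
  have hlt : a < b := by
    rw [Fin.lt_def]
    omega
  have hmem (t : F) : g * transvGL a b hne t * permGL n F (Equiv.swap a b) ∈ borel n F ↔
      (∀ i j, j < i → ¬ (i = b ∧ j = a) → g i j = 0) ∧ g b b + g b a * t = 0 := by
    simp only [mem_borel, mul_permGL_apply, mul_transvGL_apply]
    constructor
    · intro h
      have hcol : ∀ i, b < i → g i a = 0 := by
        intro i hi
        simpa [hne] using h i b hi
      refine ⟨fun i j hji hij => ?_, by simpa using h b a hlt⟩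
      rcases eq_or_ne j a with rfl | hja
      · refine hcol i (lt_of_le_of_ne ?_ fun h' => hij ⟨h'.symm, rfl⟩)
        rw [Fin.le_def]
        rw [Fin.lt_def] at hji
        omega
      rcases eq_or_ne j b with rfl | hjb
      · simpa [hcol i hji] using h i a (hlt.trans hji)
      · simpa [Equiv.swap_apply_of_ne_of_ne hja hjb, hjb] using h i j hji
    · rintro ⟨h, h0⟩ i j hji
      rcases eq_or_ne j a with rfl | hja
      · rcases eq_or_ne i b with rfl | hib
        · simpa using h0
        · have hbi : b < i := by
            refine lt_of_le_of_ne ?_ hib.symm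
            rw [Fin.le_def]
            rw [Fin.lt_def] at hji
            omega
          simp [h i b hbi (fun h => hib h.1), h i j hji (fun h => hib h.1)]
      rcases eq_or_ne j b with rfl | hjb
      · simp [hne, h i a (hlt.trans hji) fun h' => hji.ne' h'.1]
      · simpa [Equiv.swap_apply_of_ne_of_ne hja hjb, hjb] using h i j hji fun h' => hja h'.2
  have hmem' : g ∈ borel n F ↔
      (∀ i j, j < i → ¬ (i = b ∧ j = a) → g i j = 0) ∧ g b a = 0 := by
    refine ⟨fun h => ⟨fun i j hji _ => h i j hji, h b a hlt⟩, ?_⟩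
    rintro ⟨h, h0⟩ i j hji
    by_cases hij : i = b ∧ j = a
    · rw [hij.1, hij.2, h0]
    · exact h i j hji hij
  simp only [hmem]
  by_cases hp : ∀ i j, j < i → ¬ (i = b ∧ j = a) → g i j = 0
  · by_cases h0 : g b a = 0
    · have hB := hmem'.2 ⟨hp, h0⟩
      rw [if_pos hB, if_pos hp]
      simp [h0, borel_diag_ne_zero hB]
    · rw [if_neg fun h => h0 (hmem'.1 h).2, if_pos hp, zero_add,
        Finset.sum_eq_single (-(g b b) / g b a)]
      · rw [if_pos]
        refine ⟨hp, ?_⟩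
        field_simp
        ring
      · intro t _ ht
        rw [if_neg]
        rintro ⟨-, h⟩
        apply ht
        rw [eq_div_iff h0]
        linear_combination h
      · simp
  · rw [if_neg fun h => hp (hmem'.1 h).1, if_neg hp, zero_add]
    exact Finset.sum_eq_zero fun t _ => if_neg fun h => hp h.1

variable [Finite F]

noncomputable instance unipFintype : Fintype (unip n F) := Fintype.ofFinite _

noncomputable instance pattFintype (σ : Equiv.Perm (Fin n)) : Fintype (patt F σ) :=
  Fintype.ofFinite _

theorem coeff_of_mul {G : Type*} [Group G] (g : G) (x : R[G]) (h : G) :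
    (MonoidAlgebra.of R G g * x).coeff h = x.coeff (g⁻¹ * h) := by
  simp [MonoidAlgebra.of_apply]

open Classical in
theorem coeff_hatSum {G : Type*} [Group G] [Finite G] (S : Set G) (g : G) :
    (hatSum R S).coeff g = if g ∈ S then 1 else 0 := by
  simp [hatSum, MonoidAlgebra.coeff_sum, MonoidAlgebra.of_apply, MonoidAlgebra.coeff_single,
    Finsupp.single_apply, Finsupp.finsetSum_apply]

open Classical in
theorem coeff_steinbergElement (g : GL (Fin n) F) :
    (steinbergElement n F R).coeff g = ∑ σ : Equiv.Perm (Fin n),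
      ((Equiv.Perm.sign σ : ℤˣ) : ℤ) •
        (if (permGL n F σ)⁻¹ * g ∈ borel n F then (1 : R) else 0) := by
  simp only [steinbergElement, MonoidAlgebra.coeff_sum, Finsupp.finsetSum_apply,
    MonoidAlgebra.coeff_smul_apply, coeff_of_mul, coeff_hatSum, SetLike.mem_coe]

-- Uniqueness in the Bruhat decomposition kills every summand of 𝐞 except the one for τ.
open Classical in
theorem coeff_steinbergElement_mul_permGL {u : GL (Fin n) F} (hu : u ∈ borel n F)
    (τ : Equiv.Perm (Fin n)) :
    (steinbergElement n F R).coeff (u * permGL n F τ) =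
      ((Equiv.Perm.sign τ : ℤˣ) : ℤ) •
        (if (permGL n F τ)⁻¹ * u * permGL n F τ ∈ borel n F then (1 : R) else 0) := by
  rw [coeff_steinbergElement, Finset.sum_eq_single τ]
  · rw [mul_assoc]
  · intro σ _ hσ
    rw [if_neg, smul_zero]
    rw [← mul_assoc]
    exact fun h => hσ (bruhat_unique hu h)
  · simp

variable [IsDomain R] [CharZero R]

/-- The elements of the Steinberg lattice sum to zero along the lines of the flag variety. -/
theorem coeff_line_sum [Fintype F] {x : R[GL (Fin n) F]} (hx : x ∈ steinberg n F R)
    {a b : Fin n} (hab : (b : ℕ) = a + 1) (hne : a ≠ b) (g : GL (Fin n) F) :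
    x.coeff g + ∑ t : F, x.coeff (g * transvGL a b hne t * permGL n F (Equiv.swap a b)) = 0 := by
  classical
  obtain ⟨c, rfl⟩ := Submodule.mem_span_singleton.1 hx
  rw [smul_eq_mul]
  induction c using MonoidAlgebra.induction_on generalizing g with
  | of h =>
    simp only [coeff_of_mul]
    rw [← Finset.sum_congr rfl fun t _ => by
      rw [← mul_assoc, ← mul_assoc]]
    generalize h⁻¹ * g = g
    simp only [coeff_steinbergElement]
    rw [Finset.sum_comm, ← Finset.sum_add_distrib]
    simp only [← Finset.smul_sum, ← smul_add]
    have key (σ : Equiv.Perm (Fin n)) := borel_line_count (R := R) hab hne ((permGL n F σ)⁻¹ * g)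
    simp only [← mul_assoc] at key ⊢
    simp only [key]
    set S := ∑ σ : Equiv.Perm (Fin n), ((Equiv.Perm.sign σ : ℤˣ) : ℤ) •
      (if (∀ i j, j < i → ¬ (i = b ∧ j = a) → ((permGL n F σ)⁻¹ * g : GL (Fin n) F) i j = 0)
        then (1 : R) else 0) with hS
    -- Replacing σ by σ(a b) swaps rows a and b, which preserves the vanishing condition but changes
    -- the sign.
    have hneg : S = -S := by
      conv_lhs => rw [hS, ← Equiv.sum_comp (Equiv.mulRight (Equiv.swap a b))]
      rw [hS, ← Finset.sum_neg_distrib]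
      refine Finset.sum_congr rfl fun σ _ => ?_
      rw [Equiv.coe_mulRight, Equiv.Perm.sign_mul, Equiv.Perm.sign_swap hne]
      simp only [mul_neg, mul_one, Units.val_neg, neg_smul]
      congr 2
      refine if_congr ?_ rfl rfl
      have hrow (i j : Fin n) : ((permGL n F (σ * Equiv.swap a b))⁻¹ * g : GL (Fin n) F) i j =
          ((permGL n F σ)⁻¹ * g : GL (Fin n) F) (Equiv.swap a b i) j := by
        rw [← map_inv, ← map_inv, permGL_mul_apply, permGL_mul_apply, inv_inv, inv_inv]
        rfl
      simp only [hrow]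
      generalize (permGL n F σ)⁻¹ * g = k
      have hlt : a < b := by
        rw [Fin.lt_def]
        omega
      have haux : ∀ m : Fin n → Fin n → F,
          (∀ i j, j < i → ¬ (i = b ∧ j = a) → m i j = 0) →
          ∀ i j, j < i → ¬ (i = b ∧ j = a) → m (Equiv.swap a b i) j = 0 := by
        intro m h i j hji hij
        rcases eq_or_ne i a with rfl | hia
        · rw [Equiv.swap_apply_left]
          exact h _ _ (hji.trans hlt) fun h' => hji.ne h'.2
        rcases eq_or_ne i b with rfl | hib
        · rw [Equiv.swap_apply_right]
          refine h _ _ (lt_of_le_of_ne ?_ fun h' => hij ⟨rfl, h'⟩) fun h' => hne h'.1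
          rw [Fin.le_def]
          rw [Fin.lt_def] at hji
          omega
        · rw [Equiv.swap_apply_of_ne_of_ne hia hib]
          exact h _ _ hji hij
      refine ⟨fun h => ?_, fun h => haux (fun i j => k i j) h⟩
      have := haux (fun i j => k (Equiv.swap a b i) j) h
      simpa using this
    have h2 : (2 : R) * S = 0 := by linear_combination hneg
    exact (mul_eq_zero.1 h2).resolve_left two_ne_zero
  | add c d hc hd =>
    have h1 := hc g (Submodule.mem_span_singleton.2 ⟨c, rfl⟩)
    have h2 := hd g (Submodule.mem_span_singleton.2 ⟨d, rfl⟩)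
    simp only [add_mul, MonoidAlgebra.coeff_add, Finsupp.add_apply, Finset.sum_add_distrib]
    linear_combination h1 + h2
  | smul r c hc =>
    have h1 := hc g (Submodule.mem_span_singleton.2 ⟨c, rfl⟩)
    simp only [smul_mul_assoc, MonoidAlgebra.coeff_smul_apply, ← Finset.smul_sum, ← smul_add, h1,
      smul_zero]

end Coefficients

/-! ### The big cell gives coordinates on I. -/

section BigCell

variable {n : ℕ}

theorem lt_of_adjacent {β : Fin n → ℕ} (hβ : Monotone β) {f : Fin n → Fin n}
    (h : ∀ a b : Fin n, (b : ℕ) = a + 1 → β a = β b → f b < f a) (a b : Fin n) (hab : a < b)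
    (hb : β a = β b) : f b < f a := by
  obtain ⟨d, hd⟩ : ∃ d, (b : ℕ) = a + d + 1 := by
    rw [Fin.lt_def] at hab
    exact ⟨b - a - 1, by omega⟩
  induction d generalizing b with
  | zero => exact h a b hd hb
  | succ d ih =>
    let c : Fin n := ⟨a + d + 1, by omega⟩
    have hac : a < c := by
      rw [Fin.lt_def]
      simp only [c]
      omega
    have hcb : c < b := by
      rw [Fin.lt_def]
      simp only [c]
      omega
    have hβc : β a = β c := le_antisymm (hβ hac.le) ((hβ hcb.le).trans hb.ge)
    refine (h c b ?_ (hβc.symm.trans hb)).trans (ih c hac hβc rfl)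
    simp only [c]
    omega

theorem eq_revPerm_of_adjacent {σ : Equiv.Perm (Fin n)}
    (h : ∀ a b : Fin n, (b : ℕ) = a + 1 → σ b < σ a) : σ = Fin.revPerm := by
  have h1 := lt_of_adjacent (β := fun _ => 0) monotone_const (f := σ) fun a b hab _ => h a b hab
  have h2 : σ * Fin.revPerm = 1 := by
    refine (Equiv.Perm.monotone_iff _).1 (StrictMono.monotone fun a b hab => ?_)
    exact h1 _ _ (Fin.rev_lt_rev.2 hab) rfl
  rw [mul_eq_one_iff_eq_inv.1 h2]
  ext a
  simp [Fin.revPerm]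

/-- A statistic on permutations that goes down when an ascent is removed. -/
def ascentWeight (σ : Equiv.Perm (Fin n)) : ℕ := ∑ k : Fin n, (k : ℕ) * (σ k : ℕ)

theorem ascentWeight_mul_swap_lt {σ : Equiv.Perm (Fin n)} {a b : Fin n} (hab : a < b)
    (h : σ a < σ b) : ascentWeight (σ * Equiv.swap a b) < ascentWeight σ := by
  have hmem : b ∈ Finset.univ.erase a := Finset.mem_erase.2 ⟨hab.ne', Finset.mem_univ b⟩
  unfold ascentWeight
  rw [← Finset.add_sum_erase _ _ (Finset.mem_univ a), ← Finset.add_sum_erase _ _ hmem,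
    ← Finset.add_sum_erase Finset.univ (fun k : Fin n => (k : ℕ) * (σ k : ℕ)) (Finset.mem_univ a),
    ← Finset.add_sum_erase _ (fun k : Fin n => (k : ℕ) * (σ k : ℕ)) hmem,
    Finset.sum_congr (g := fun k : Fin n => (k : ℕ) * (σ k : ℕ)) rfl fun k hk => ?_]
  · simp only [Equiv.Perm.mul_apply, Equiv.swap_apply_left, Equiv.swap_apply_right]
    rw [Fin.lt_def] at hab h
    nlinarith
  · simp only [Finset.mem_erase] at hk
    rw [Equiv.Perm.mul_apply, Equiv.swap_apply_of_ne_of_ne hk.2.1 hk.1]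

variable {F : Type*} [Field F]

theorem eq_one_of_mem_patt_rev {u : GL (Fin n) F}
    (hu : u ∈ patt F (Fin.revPerm : Equiv.Perm (Fin n))) : u = 1 := by
  obtain ⟨h1, h2⟩ := mem_patt_iff.1 hu
  ext i j
  rcases lt_trichotomy i j with h | rfl | h
  · rw [h2 i j (Fin.rev_lt_rev.2 h), Units.val_one, Matrix.one_apply_ne h.ne]
  · rw [h1.2, Units.val_one, Matrix.one_apply_eq]
  · rw [h1.1 _ _ h, Units.val_one, Matrix.one_apply_ne h.ne']

variable [Finite F] {R : Type*} [CommRing R]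

variable (n F R) in
/-- The generator of the Steinberg lattice. -/
noncomputable def generator : steinberg n F R :=
  ⟨steinbergElement n F R, Submodule.mem_span_singleton_self _⟩

theorem coe_smul_steinberg (a : R[GL (Fin n) F]) (x : steinberg n F R) :
    ((a • x : steinberg n F R) : R[GL (Fin n) F]) = a * x := rfl

theorem coeff_smul_steinberg (r : R) (x : steinberg n F R) (g : GL (Fin n) F) :
    ((r • x : steinberg n F R) : R[GL (Fin n) F]).coeff g =
      r * (x : R[GL (Fin n) F]).coeff g := rfl

variable (R) in
/-- The sign of the longest permutation. -/
noncomputable def signRev (n : ℕ) : R :=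
  (((Equiv.Perm.sign (Fin.revPerm : Equiv.Perm (Fin n)) : ℤˣ) : ℤ) : R)

theorem sign_mul_sign (σ : Equiv.Perm (Fin n)) :
    (((Equiv.Perm.sign σ : ℤˣ) : ℤ) : R) * (((Equiv.Perm.sign σ : ℤˣ) : ℤ) : R) = 1 := by
  rw [← Int.cast_mul, Int.units_coe_mul_self, Int.cast_one]

variable [IsDomain R] [CharZero R]

/-- An element of the Steinberg lattice is determined by its coefficients on the big cell. -/
theorem eq_zero_of_coeff_bigCell {x : R[GL (Fin n) F]} (hx : x ∈ steinberg n F R)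
    (h : ∀ u ∈ unip n F, x.coeff (u * permGL n F Fin.revPerm) = 0) : x = 0 := by
  have _ := Fintype.ofFinite F
  have key : ∀ k, ∀ σ : Equiv.Perm (Fin n), ascentWeight σ = k →
      ∀ u ∈ unip n F, x.coeff (u * permGL n F σ) = 0 := by
    intro k
    induction k using Nat.strong_induction_on with
    | _ k ih =>
    intro σ hσ u hu
    by_cases hrev : ∀ a b : Fin n, (b : ℕ) = a + 1 → σ b < σ a
    · rw [eq_revPerm_of_adjacent hrev]
      exact h u hu
    push Not at hrev
    obtain ⟨a, b, hab, hle⟩ := hrev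
    have hlt : a < b := by
      rw [Fin.lt_def]
      omega
    have hσlt : σ a < σ b := lt_of_le_of_ne hle fun h' => hlt.ne (σ.injective h')
    -- The other points of this line are u x σ(a b)B with x in the root subgroup at (σ a, σ b). As σ
    -- a < σ b, x lies in U, and σ(a b) has smaller weight, so induction applies.
    have := coeff_line_sum hx hab hlt.ne (u * permGL n F σ)
    rw [Finset.sum_eq_zero, add_zero] at this
    · exact this
    · intro t _
      rw [mul_assoc u, permGL_mul_transvGL, ← mul_assoc, mul_assoc, ← map_mul]
      exact ih _ (hσ ▸ ascentWeight_mul_swap_lt hlt hσlt) _ rfl _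
        (mul_mem hu (transvGL_mem_unip hσlt t))
  ext g
  obtain ⟨u, hu, σ, b, hb, rfl⟩ := bruhat g
  rw [coeff_mul_right_of_mem hx _ hb]
  exact key _ σ rfl u hu

/-- The elements `u 𝐞`, `u ∈ U`, span the Steinberg lattice; the coordinates are the coefficients
on the big cell. -/
theorem eq_sum_bigCell (x : steinberg n F R) :
    x = signRev R n • ∑ u : unip n F, (x : R[GL (Fin n) F]).coeff
      (u * permGL n F Fin.revPerm) • MonoidAlgebra.of R _ (u : GL (Fin n) F) • generator n F R := by
  classical
  rw [← sub_eq_zero]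
  refine Subtype.ext (eq_zero_of_coeff_bigCell (SetLike.coe_mem _) fun v hv => ?_)
  rw [AddSubgroupClass.coe_sub, MonoidAlgebra.coeff_sub, Finsupp.sub_apply, coeff_smul_steinberg,
    AddSubmonoidClass.coe_finsetSum, MonoidAlgebra.coeff_sum, Finsupp.finsetSum_apply]
  simp only [coeff_smul_steinberg, coe_smul_steinberg, coeff_of_mul]
  -- Since U ∩ w₀Bw₀⁻¹ is trivial, u𝐞 has a nonzero coefficient at vw₀ only for u = v, where it is
  -- the sign of w₀.
  rw [Finset.sum_eq_single ⟨v, hv⟩]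
  · have h1 := coeff_steinbergElement_mul_permGL (R := R) (one_mem (borel n F))
      (Fin.revPerm : Equiv.Perm (Fin n))
    rw [one_mul, if_pos (by simp)] at h1
    simp only [inv_mul_cancel_left, generator]
    rw [h1, mul_left_comm]
    simp [signRev, sign_mul_sign]
  · intro u _ hu
    have h1 := coeff_steinbergElement_mul_permGL (R := R)
      (unip_le_borel (mul_mem (inv_mem u.2) hv)) (Fin.revPerm : Equiv.Perm (Fin n))
    rw [if_neg, smul_zero] at h1
    · rw [← mul_assoc]
      simp only [generator]
      rw [h1, mul_zero]
    · intro h2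
      apply hu
      have := eq_one_of_mem_patt_rev (mem_patt.2 ⟨mul_mem (inv_mem u.2) hv, h2⟩)
      exact Subtype.ext (inv_mul_eq_one.1 this)
  · simp

end BigCell

/-! ### Components of I under linear characters of U. -/

section HatChar

variable {n : ℕ} {F : Type*} [Field F] {R : Type*} [CommRing R]

theorem char_inv_mul (χ : unip n F →* R) (u : unip n F) : χ u⁻¹ * χ u = 1 := by
  rw [← map_mul, inv_mul_cancel, map_one]

/-- The inverse of a linear character of `U`. -/
def conjChar (χ : unip n F →* R) : unip n F →* R where
  toFun u := χ u⁻¹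
  map_one' := by simp
  map_mul' u v := by rw [mul_inv_rev, map_mul, mul_comm]

theorem conjChar_apply (χ : unip n F →* R) (u : unip n F) : conjChar χ u = χ u⁻¹ := rfl

variable [Finite F]

/-- The multiple `∑ χ(u⁻¹) u` of the idempotent of a linear character `χ` of `U`. -/
noncomputable def hatChar (χ : unip n F →* R) : R[GL (Fin n) F] :=
  ∑ u : unip n F, χ u⁻¹ • MonoidAlgebra.of R (GL (Fin n) F) u

theorem hatChar_mul_of (χ : unip n F →* R) (v : unip n F) :
    hatChar χ * MonoidAlgebra.of R (GL (Fin n) F) v = χ v • hatChar χ := by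
  unfold hatChar
  rw [Finset.sum_mul, Finset.smul_sum]
  refine Fintype.sum_equiv (Equiv.mulRight v) _ _ fun u => ?_
  have h : χ v * χ (u * v)⁻¹ = χ u⁻¹ := by
    rw [mul_inv_rev, map_mul, ← mul_assoc, mul_comm (χ v), char_inv_mul, one_mul]
  rw [smul_mul_assoc, ← map_mul, Equiv.coe_mulRight, smul_smul, h]
  rfl

theorem of_mul_hatChar (χ : unip n F →* R) (v : unip n F) :
    MonoidAlgebra.of R (GL (Fin n) F) v * hatChar χ = χ v • hatChar χ := by
  unfold hatChar
  rw [Finset.mul_sum, Finset.smul_sum]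
  refine Fintype.sum_equiv (Equiv.mulLeft v) _ _ fun u => ?_
  have h : χ v * χ (v * u)⁻¹ = χ u⁻¹ := by
    rw [mul_inv_rev, map_mul, mul_left_comm, mul_comm (χ v), char_inv_mul, mul_one]
  rw [mul_smul_comm, ← map_mul, Equiv.coe_mulLeft, smul_smul, h]
  rfl

theorem hatChar_mul_hatChar (χ : unip n F →* R) :
    hatChar χ * hatChar χ = (Nat.card (unip n F) : R) • hatChar χ := by
  conv_lhs => enter [1]; rw [hatChar]
  rw [Finset.sum_mul]
  simp only [smul_mul_assoc, of_mul_hatChar, smul_smul, char_inv_mul, one_smul]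
  rw [Finset.sum_const, Finset.card_univ, Nat.card_eq_fintype_card, Nat.cast_smul_eq_nsmul]

/-- The vector `∑ χ(u⁻¹) u 𝐞` of the Steinberg lattice. -/
noncomputable def charVec (χ : unip n F →* R) : steinberg n F R := hatChar χ • generator n F R

theorem hatChar_smul_charVec (χ : unip n F →* R) :
    hatChar χ • charVec χ = (Nat.card (unip n F) : R) • charVec χ := by
  rw [charVec, smul_smul, hatChar_mul_hatChar, smul_assoc]

theorem of_smul_charVec (χ : unip n F →* R) (v : unip n F) :
    MonoidAlgebra.of R (GL (Fin n) F) v • charVec χ = χ v • charVec χ := by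
  rw [charVec, smul_smul, of_mul_hatChar, smul_assoc]

theorem coeff_hatChar_smul (χ : unip n F →* R) (x : steinberg n F R) (g : GL (Fin n) F) :
    ((hatChar χ • x : steinberg n F R) : R[GL (Fin n) F]).coeff g =
      ∑ u : unip n F, χ u * (x : R[GL (Fin n) F]).coeff (u * g) := by
  rw [coe_smul_steinberg, hatChar, Finset.sum_mul, MonoidAlgebra.coeff_sum,
    Finsupp.finsetSum_apply]
  refine Fintype.sum_equiv (Equiv.inv _) _ _ fun u => ?_
  rw [smul_mul_assoc, MonoidAlgebra.coeff_smul_apply, coeff_of_mul]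
  rfl

theorem coeff_charVec_mul (χ : unip n F →* R) (v : unip n F) (g : GL (Fin n) F) :
    (charVec χ : R[GL (Fin n) F]).coeff (v * g) =
      χ v⁻¹ * (charVec χ : R[GL (Fin n) F]).coeff g := by
  have := congrArg (fun x : steinberg n F R => (x : R[GL (Fin n) F]).coeff g)
    (of_smul_charVec χ v⁻¹)
  simpa [coe_smul_steinberg, coeff_of_mul, coeff_smul_steinberg] using this

theorem coeff_charVec_permGL (χ : unip n F →* R) (σ : Equiv.Perm (Fin n)) :
    (charVec χ : R[GL (Fin n) F]).coeff (permGL n F σ) =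
      (((Equiv.Perm.sign σ : ℤˣ) : ℤ) : R) *
        ∑ u : patt F σ, χ ⟨u, (mem_patt.1 u.2).1⟩ := by
  classical
  rw [charVec, coeff_hatChar_smul, Finset.mul_sum]
  simp only [generator, fun u : unip n F =>
    coeff_steinbergElement_mul_permGL (R := R) (unip_le_borel u.2) σ, zsmul_eq_mul]
  symm
  have hinj : Function.Injective
      (fun u : patt F σ => (⟨u, (mem_patt.1 u.2).1⟩ : unip n F)) :=
    fun u v h => Subtype.ext (congrArg (fun x : unip n F => (x : GL (Fin n) F)) h)
  rw [← Finset.sum_image (s := Finset.univ) (g := fun u : patt F σ =>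
    (⟨u, (mem_patt.1 u.2).1⟩ : unip n F)) (f := fun u : unip n F =>
      (((Equiv.Perm.sign σ : ℤˣ) : ℤ) : R) * χ u) hinj.injOn]
  refine (Finset.sum_congr rfl fun u hu => ?_).trans
    (Finset.sum_subset (Finset.subset_univ _) fun u _ hu => ?_)
  · obtain ⟨v, -, rfl⟩ := Finset.mem_image.1 hu
    rw [if_pos (mem_patt.1 v.2).2]
    ring
  · rw [if_neg, mul_zero, mul_zero]
    exact fun h => hu (Finset.mem_image.2 ⟨⟨u, mem_patt.2 ⟨u.2, h⟩⟩, Finset.mem_univ _, rfl⟩)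

variable [IsDomain R] [CharZero R]

/-- The `χ`-isotypic component of the Steinberg lattice has rank one. -/
theorem hatChar_smul_eq (χ : unip n F →* R) (x : steinberg n F R) :
    ∃ r : R, hatChar χ • x = r • charVec χ := by
  refine ⟨signRev R n * ∑ u : unip n F,
    (x : R[GL (Fin n) F]).coeff (u * permGL n F Fin.revPerm) * χ u, ?_⟩
  conv_lhs => rw [eq_sum_bigCell x]
  rw [smul_comm, mul_smul, Finset.smul_sum, Finset.sum_smul]
  congr 1
  refine Finset.sum_congr rfl fun u _ => ?_
  rw [smul_comm, smul_smul (hatChar χ), hatChar_mul_of, smul_assoc, smul_smul, charVec]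

theorem steinbergForm_of_smul (g : GL (Fin n) F) (x y : steinberg n F R) :
    steinbergForm n F R (MonoidAlgebra.of R _ g • x) y =
      steinbergForm n F R x (MonoidAlgebra.of R _ g⁻¹ • y) := by
  have hB : (Nat.card (borel n F) : R) ≠ 0 := Nat.cast_ne_zero.2 Nat.card_pos.ne'
  refine mul_left_cancel₀ hB ?_
  rw [card_mul_steinbergForm, card_mul_steinbergForm]
  exact canonicalForm_of_mul g _ _

/-- By invariance of f the adjoint of u is u⁻¹, and reindexing by inversion replaces χ by its
inverse. -/
theorem steinbergForm_hatChar_smul (χ : unip n F →* R) (x y : steinberg n F R) :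
    steinbergForm n F R (hatChar χ • x) y =
      steinbergForm n F R x (hatChar (conjChar χ) • y) := by
  unfold hatChar
  rw [Finset.sum_smul, Finset.sum_smul, map_sum, map_sum, LinearMap.sum_apply]
  refine Fintype.sum_equiv (Equiv.inv _) _ _ fun u => ?_
  rw [smul_assoc, smul_assoc, LinearMap.map_smul (steinbergForm n F R), LinearMap.map_smul,
    LinearMap.smul_apply, steinbergForm_of_smul, conjChar_apply]
  simp

theorem steinbergForm_generator (x : steinberg n F R) :
    steinbergForm n F R x (generator n F R) = ∑ σ : Equiv.Perm (Fin n),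
      (((Equiv.Perm.sign σ : ℤˣ) : ℤ) : R) * (x : R[GL (Fin n) F]).coeff (permGL n F σ) := by
  classical
  have hB : (Nat.card (borel n F) : R) ≠ 0 := Nat.cast_ne_zero.2 Nat.card_pos.ne'
  refine mul_left_cancel₀ hB ?_
  let _ := Fintype.ofFinite (GL (Fin n) F)
  rw [card_mul_steinbergForm, canonicalForm_apply]
  simp only [generator, coeff_steinbergElement, Finset.mul_sum]
  rw [Finset.sum_comm]
  refine Finset.sum_congr rfl fun σ _ => ?_
  rw [← Equiv.sum_comp (Equiv.mulLeft (permGL n F σ))]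
  simp only [Equiv.coe_mulLeft, inv_mul_cancel_left, zsmul_eq_mul]
  have h (g : GL (Fin n) F) : (x : R[GL (Fin n) F]).coeff (permGL n F σ * g) *
      ((((Equiv.Perm.sign σ : ℤˣ) : ℤ) : R) * if g ∈ borel n F then 1 else 0) =
      if g ∈ borel n F then (((Equiv.Perm.sign σ : ℤˣ) : ℤ) : R) *
        (x : R[GL (Fin n) F]).coeff (permGL n F σ) else 0 := by
    split_ifs with hg
    · rw [coeff_mul_right_of_mem x.2 _ hg]
      ring
    · simp
  simp only [h]
  rw [← Finset.sum_filter, Finset.sum_const, nsmul_eq_mul, Nat.card_eq_fintype_card,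
    Fintype.card_subtype]

theorem steinbergForm_charVec_generator (χ : unip n F →* R) :
    steinbergForm n F R (charVec χ) (generator n F R) =
      ∑ σ : Equiv.Perm (Fin n), ∑ u : patt F σ, χ ⟨u, (mem_patt.1 u.2).1⟩ := by
  rw [steinbergForm_generator]
  refine Finset.sum_congr rfl fun σ _ => ?_
  rw [coeff_charVec_permGL, ← mul_assoc, sign_mul_sign, one_mul]

/-- U acts on `charVec χ` by scalars and I is spanned by the u𝐞, so membership of its multiples in
I(c) need only be tested against 𝐞. -/
theorem steinbergForm_charVec (χ : unip n F →* R) (y : steinberg n F R) :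
    ∃ r : R, steinbergForm n F R (charVec χ) y =
      steinbergForm n F R (charVec χ) (generator n F R) * r := by
  refine ⟨signRev R n * ∑ u : unip n F,
    (y : R[GL (Fin n) F]).coeff (u * permGL n F Fin.revPerm) * χ u⁻¹, ?_⟩
  conv_lhs => rw [eq_sum_bigCell y]
  rw [LinearMap.map_smul, map_sum, smul_eq_mul, mul_left_comm]
  congr 1
  rw [Finset.mul_sum]
  refine Finset.sum_congr rfl fun u _ => ?_
  rw [LinearMap.map_smul, ← inv_inv (u : GL (Fin n) F), ← steinbergForm_of_smul, inv_inv]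
  have := of_smul_charVec χ u⁻¹
  rw [InvMemClass.coe_inv] at this
  rw [this, LinearMap.map_smul, LinearMap.smul_apply, smul_eq_mul, smul_eq_mul]
  ring

end HatChar

/-! ### Characters attached to P, and the index as a value of the form. -/

section LinearCharacters

variable {n : ℕ} {F : Type*} [Field F] {R : Type*} [CommRing R]

theorem unip_mul_apply_adjacent {u v : GL (Fin n) F} (hu : u ∈ unip n F) (hv : v ∈ unip n F)
    {i j : Fin n} (hij : (j : ℕ) = i + 1) : (u * v : GL (Fin n) F) i j = u i j + v i j := by
  have hlt : i < j := by
    rw [Fin.lt_def]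
    omega
  rw [Units.val_mul, Matrix.mul_apply, Finset.sum_eq_add i j hlt.ne]
  · rw [hu.2, hv.2]
    ring
  · rintro k - ⟨hki, hkj⟩
    rcases lt_or_gt_of_ne hki with h | h
    · rw [hu.1 _ _ h, zero_mul]
    · rw [hv.1 _ _ (lt_of_le_of_ne ?_ hkj.symm), mul_zero]
      rw [Fin.lt_def] at h
      rw [Fin.le_def]
      omega
  · simp
  · simp

/-- The adjacent pairs of indices in the same fibre of `β`. -/
def adjacentPairs (β : Fin n → ℕ) : Finset (Fin n × Fin n) :=
  {p | (p.2 : ℕ) = p.1 + 1 ∧ β p.1 = β p.2}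

theorem mem_adjacentPairs {β : Fin n → ℕ} {p : Fin n × Fin n} :
    p ∈ adjacentPairs β ↔ (p.2 : ℕ) = p.1 + 1 ∧ β p.1 = β p.2 := by
  simp [adjacentPairs]

/-- The linear character of `U` that is nontrivial exactly on the simple root subgroups that belong
to adjacent indices in the same fibre of `β`. -/
def blockChar (ψ : AddChar F R) (β : Fin n → ℕ) : unip n F →* R where
  toFun u := ψ (∑ p ∈ adjacentPairs β, (u : GL (Fin n) F) p.1 p.2)
  map_one' := by
    rw [Finset.sum_eq_zero, AddChar.map_zero_eq_one]
    intro p hp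
    have h1 := (mem_adjacentPairs.1 hp).1
    rw [OneMemClass.coe_one, Units.val_one, Matrix.one_apply_ne]
    rintro h
    rw [h] at h1
    omega
  map_mul' u v := by
    rw [← AddChar.map_add_eq_mul, ← Finset.sum_add_distrib]
    congr 1
    refine Finset.sum_congr rfl fun p hp => ?_
    exact unip_mul_apply_adjacent u.2 v.2 (mem_adjacentPairs.1 hp).1

theorem blockChar_apply (ψ : AddChar F R) (β : Fin n → ℕ) (u : unip n F) :
    blockChar ψ β u = ψ (∑ p ∈ adjacentPairs β, (u : GL (Fin n) F) p.1 p.2) := rfl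

theorem blockChar_of_mem_patt (ψ : AddChar F R) {β : Fin n → ℕ} {σ : Equiv.Perm (Fin n)}
    (hσ : InvDecOn β σ) {u : unip n F} (hu : (u : GL (Fin n) F) ∈ patt F σ) :
    blockChar ψ β u = 1 := by
  rw [blockChar_apply, Finset.sum_eq_zero, AddChar.map_zero_eq_one]
  rintro ⟨i, j⟩ hp
  obtain ⟨h1, h2⟩ := mem_adjacentPairs.1 hp
  refine (mem_patt_iff.1 hu).2 _ _ (hσ _ _ ?_ h2)
  rw [Fin.lt_def]
  omega

/-- By `lt_of_adjacent` a failure of decrease occurs already at two adjacent indices of one fibre.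
Their simple root subgroup lies in the pattern group, and the character restricts to ψ on it. -/
theorem exists_blockChar_ne_one {ψ : AddChar F R} (hψ : ψ ≠ 1) {β : Fin n → ℕ}
    (hβ : Monotone β) {σ : Equiv.Perm (Fin n)} (hσ : ¬ InvDecOn β σ) :
    ∃ u : unip n F, (u : GL (Fin n) F) ∈ patt F σ ∧ blockChar ψ β u ≠ 1 := by
  obtain ⟨i, j, hij, hβij, hle⟩ : ∃ i j : Fin n, (j : ℕ) = i + 1 ∧ β i = β j ∧ σ⁻¹ i ≤ σ⁻¹ j := by
    by_contra! h
    exact hσ (lt_of_adjacent hβ (f := ⇑σ⁻¹) h)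
  have hlt : i < j := by
    rw [Fin.lt_def]
    omega
  obtain ⟨t, ht⟩ : ∃ t, ψ t ≠ 1 := by
    by_contra! h
    exact hψ (by ext; simp [h])
  refine ⟨⟨transvGL i j hlt.ne t, transvGL_mem_unip hlt t⟩,
    mem_patt_iff.2 ⟨transvGL_mem_unip hlt t, fun a b hab => ?_⟩, ?_⟩
  · rw [transvGL_apply, if_neg, if_neg, add_zero]
    · rintro ⟨rfl, rfl⟩
      exact absurd hab (not_lt.2 hle)
    · rintro rfl
      exact lt_irrefl _ hab
  · rw [blockChar_apply, Finset.sum_eq_single (i, j)]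
    · simpa [transvGL_apply, hlt.ne] using ht
    · rintro ⟨a, b⟩ hp hne
      have h1 := (mem_adjacentPairs.1 hp).1
      rw [transvGL_apply, if_neg, if_neg, add_zero]
      · rintro ⟨rfl, rfl⟩
        exact hne rfl
      · intro h
        rw [h] at h1
        omega
    · exact fun h => absurd (mem_adjacentPairs.2 ⟨hij, hβij⟩) h

variable [Finite F] [IsDomain R]

open Classical in
theorem sum_blockChar_patt {ψ : AddChar F R} (hψ : ψ ≠ 1) {β : Fin n → ℕ}
    (hβ : Monotone β) (σ : Equiv.Perm (Fin n)) :
    ∑ u : patt F σ, blockChar ψ β ⟨u, (mem_patt.1 u.2).1⟩ =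
      ((if InvDecOn β σ then Nat.card (patt F σ) else 0 : ℕ) : R) := by
  split_ifs with h
  · rw [Finset.sum_congr rfl fun u _ => blockChar_of_mem_patt ψ h u.2, Finset.sum_const,
      Finset.card_univ, nsmul_eq_mul, mul_one, Nat.card_eq_fintype_card]
  · obtain ⟨u, hu, hne⟩ := exists_blockChar_ne_one hψ hβ h
    have hle : patt F σ ≤ unip n F := fun u hu => (mem_patt.1 hu).1
    rw [Nat.cast_zero]
    refine sum_hom_units_eq_zero ((blockChar ψ β).comp (Subgroup.inclusion hle)) fun h1 => hne ?_
    exact DFunLike.congr_fun h1 ⟨u, hu⟩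

variable [CharZero R]

/-- The values of the form on `χ`-vectors are the indices of the standard parabolic subgroups. -/
theorem steinbergForm_charVec_blockChar {ψ : AddChar F R} (hψ : ψ ≠ 1)
    {P : Subgroup (GL (Fin n) F)} (hP : borel n F ≤ P) :
    steinbergForm n F R (charVec (blockChar ψ (block P))) (generator n F R) = (P.index : R) := by
  rw [steinbergForm_charVec_generator, index_eq_sum_patt hP, Nat.cast_sum]
  exact Finset.sum_congr rfl fun σ _ => sum_blockChar_patt hψ (block_monotone hP) σ

end LinearCharacters

/-! ### Reversing the order of the blocks. -/

section BlockReversal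

variable {n : ℕ} {F : Type*} [Field F]

/-- The permutation that reverses the order of the fibres of `β` and is increasing on each. -/
def blockRev (β : Fin n → ℕ) : Equiv.Perm (Fin n) := (Tuple.sort fun a => OrderDual.toDual (β a))⁻¹

theorem blockRev_lt_of_eq {β : Fin n → ℕ} {a b : Fin n} (h : β a = β b) (hab : a < b) :
    blockRev β a < blockRev β b := by
  by_contra! hle
  have hlt := lt_of_le_of_ne hle fun h' => hab.ne' ((blockRev β).injective h')
  have := ((Tuple.eq_sort_iff (f := fun a => OrderDual.toDual (β a))).1 rfl).2 _ _ hlt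
  simp only [blockRev, perm_apply_inv] at this
  exact lt_asymm hab (this (by rw [h]))

theorem blockRev_lt_of_lt {β : Fin n → ℕ} {a b : Fin n} (h : β a < β b) :
    blockRev β b < blockRev β a := by
  by_contra! hle
  have := Tuple.monotone_sort (fun a => OrderDual.toDual (β a)) hle
  simp only [blockRev, Function.comp_apply, perm_apply_inv] at this
  exact absurd (OrderDual.toDual_le_toDual.1 this) (not_le.2 h)

/-- Fibres and their images are intervals, and the order inside each is kept, so neighbours in a
fibre stay neighbours. -/
theorem blockRev_adjacent {β : Fin n → ℕ} (hβ : Monotone β) {a b : Fin n} (h : β a = β b) :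
    (blockRev β b : ℕ) = blockRev β a + 1 ↔ (b : ℕ) = a + 1 := by
  have hmono {a b : Fin n} (h : β a = β b) (hlt : blockRev β a < blockRev β b) : a < b := by
    by_contra! hle
    rcases hle.eq_or_lt with rfl | hlt'
    · exact lt_irrefl _ hlt
    · exact lt_asymm hlt (blockRev_lt_of_eq h.symm hlt')
  constructor
  · intro h1
    have hab : a < b := hmono h (by rw [Fin.lt_def]; omega)
    by_contra hne
    let c : Fin n := ⟨a + 1, by omega⟩
    have hac : a < c := by
      rw [Fin.lt_def]
      exact Nat.lt_succ_self _
    have hcb : c < b := by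
      rw [Fin.lt_def] at hab ⊢
      simp only [c]
      omega
    have hc : β a = β c := le_antisymm (hβ hac.le) ((hβ hcb.le).trans h.ge)
    have h2 := blockRev_lt_of_eq hc hac
    have h3 := blockRev_lt_of_eq (hc.symm.trans h) hcb
    rw [Fin.lt_def] at h2 h3
    omega
  · intro h1
    have hab : a < b := by
      rw [Fin.lt_def]
      omega
    have hlt := blockRev_lt_of_eq h hab
    by_contra hne
    let c' : Fin n := ⟨blockRev β a + 1, by omega⟩
    obtain ⟨c, hc⟩ := (blockRev β).surjective c'
    have hac : blockRev β a < blockRev β c := by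
      rw [hc, Fin.lt_def]
      exact Nat.lt_succ_self _
    have hcb : blockRev β c < blockRev β b := by
      rw [Fin.lt_def] at hlt
      rw [hc, Fin.lt_def]
      simp only [c']
      omega
    have hβc : β a = β c := by
      rcases lt_trichotomy (β a) (β c) with h' | h' | h'
      · exact absurd hac (blockRev_lt_of_lt h').not_gt
      · exact h'
      · exact absurd hcb (blockRev_lt_of_lt (h ▸ h')).not_gt
    have h2 := hmono hβc hac
    have h3 := hmono (hβc.symm.trans h) hcb
    rw [Fin.lt_def] at h2 h3
    omega

/-- The block diagonal part of a unitriangular matrix. -/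
noncomputable def blockDiag (β : Fin n → ℕ) (u : unip n F) : GL (Fin n) F :=
  ofUpper (fun i j => if β i = β j then (u : GL (Fin n) F) i j else 0)
    (fun i j h => by
      rw [u.2.1 i j h, ite_self])
    (fun i => by
      rw [if_pos rfl, u.2.2]
      exact one_ne_zero)

theorem blockDiag_apply (β : Fin n → ℕ) (u : unip n F) (i j : Fin n) :
    blockDiag β u i j = if β i = β j then (u : GL (Fin n) F) i j else 0 := rfl

theorem blockDiag_mem_unip (β : Fin n → ℕ) (u : unip n F) : blockDiag β u ∈ unip n F :=
  ⟨ofUpper_mem_borel _ _ _, fun i => by rw [blockDiag_apply, if_pos rfl, u.2.2]⟩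

/-- This is the Levi factorization u = Lv. The free positions for w⁻¹w₀ are those above the diagonal
between different blocks, and inside a block L⁻¹u has the same entries as L⁻¹L = 1. -/
theorem blockDiag_inv_mul_mem_patt {β : Fin n → ℕ} (hβ : Monotone β) (u : unip n F) :
    (blockDiag β u)⁻¹ * u ∈ patt F ((blockRev β)⁻¹ * Fin.revPerm) := by
  have hL := inv_mem (blockDiag_mem_unip β u)
  have hv := mul_mem hL u.2
  refine mem_patt_iff.2 ⟨hv, fun i j hij => ?_⟩
  rw [mul_inv_rev, inv_inv] at hij
  have hij : blockRev β i < blockRev β j := Fin.rev_lt_rev.1 hij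
  rcases lt_trichotomy j i with hlt | rfl | hlt
  · exact hv.1 _ _ hlt
  · exact absurd hij (lt_irrefl _)
  have heq : β i = β j := by
    rcases (hβ hlt.le).eq_or_lt with h | h
    · exact h
    · exact absurd hij (blockRev_lt_of_lt h).not_gt
  have h1 : ((blockDiag β u)⁻¹ * blockDiag β u : GL (Fin n) F) i j = 0 := by
    rw [inv_mul_cancel, Units.val_one, Matrix.one_apply_ne hlt.ne]
  rw [← h1, Units.val_mul, Units.val_mul, Matrix.mul_apply, Matrix.mul_apply]
  refine Finset.sum_congr rfl fun c _ => ?_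
  rcases lt_or_ge c i with hc | hc
  · rw [hL.1 _ _ hc, zero_mul, zero_mul]
  rcases lt_or_ge j c with hc' | hc'
  · rw [u.2.1 _ _ hc', (blockDiag_mem_unip β u).1 _ _ hc']
  · rw [blockDiag_apply, if_pos (le_antisymm (hβ hc') (heq.symm.le.trans (hβ hc)))]

theorem conj_blockDiag_mem_unip {β : Fin n → ℕ} (u : unip n F) :
    permGL n F (blockRev β) * blockDiag β u * (permGL n F (blockRev β))⁻¹ ∈ unip n F := by
  have h (i j : Fin n) : (permGL n F (blockRev β) * blockDiag β u * (permGL n F (blockRev β))⁻¹ :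
      GL (Fin n) F) i j = blockDiag β u ((blockRev β)⁻¹ i) ((blockRev β)⁻¹ j) := by
    rw [← map_inv, mul_permGL_apply, permGL_mul_apply]
  refine ⟨fun i j hji => ?_, fun i => ?_⟩
  · rw [h, blockDiag_apply]
    split_ifs with heq
    · refine u.2.1 _ _ ?_
      by_contra! hle
      rcases hle.eq_or_lt with h' | h'
      · exact hji.ne' ((blockRev β)⁻¹.injective h')
      · have := blockRev_lt_of_eq heq h'
        rw [perm_apply_inv, perm_apply_inv] at this
        exact lt_asymm this hji
    · rfl
  · rw [h]
    exact (blockDiag_mem_unip β u).2 _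

variable {R : Type*} [CommRing R]

/-- Superdiagonal entries inside a block stay on the superdiagonal, and the new superdiagonal
positions between two blocks hold zeros. Hence the generic character sees exactly the entries used
by β. -/
theorem blockChar_conj_blockDiag (ψ : AddChar F R) {β γ : Fin n → ℕ} (hβ : Monotone β)
    (hγ : ∀ a b, γ a = γ b) (u : unip n F) :
    blockChar ψ γ ⟨_, conj_blockDiag_mem_unip (β := β) u⟩ = blockChar ψ β u := by
  rw [blockChar_apply, blockChar_apply]
  congr 1
  simp only [adjacentPairs, Finset.sum_filter]
  rw [← Equiv.sum_comp (Equiv.prodCongr (blockRev β) (blockRev β))]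
  refine Finset.sum_congr rfl fun p _ => ?_
  simp only [Equiv.prodCongr_apply, Prod.map_fst, Prod.map_snd, hγ (blockRev β p.1)
    (blockRev β p.2), and_true, ← map_inv, mul_permGL_apply, permGL_mul_apply, perm_inv_apply,
    blockDiag_apply]
  by_cases h : β p.1 = β p.2
  · simp [h, blockRev_adjacent hβ h]
  · simp [h]

end BlockReversal

/-! ### Transition between the P-component and the generic component. -/

section Unit

variable {n : ℕ} {F : Type*} [Field F] [Finite F] {R : Type*} [CommRing R] [IsDomain R]
  [CharZero R]

/-- The translate of a generic vector by the block reversal has an invertible component in the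
direction of the vector attached to `β`. -/
theorem exists_isUnit_hatChar_smul (hU : IsUnit (Nat.card (unip n F) : R)) {β γ : Fin n → ℕ}
    (hβ : Monotone β) (hγ : ∀ a b, γ a = γ b) (ψ : AddChar F R) :
    ∃ s : R, IsUnit s ∧ hatChar (conjChar (blockChar ψ β)) •
      MonoidAlgebra.of R _ (permGL n F (blockRev β))⁻¹ • charVec (conjChar (blockChar ψ γ)) =
        s • charVec (conjChar (blockChar ψ β)) := by
  obtain ⟨s, hs⟩ := hatChar_smul_eq (conjChar (blockChar ψ β))
    (MonoidAlgebra.of R _ (permGL n F (blockRev β))⁻¹ • charVec (conjChar (blockChar ψ γ)))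
  refine ⟨s, ?_, hs⟩
  set w := blockRev β with hw
  set σ : Equiv.Perm (Fin n) := w⁻¹ * Fin.revPerm with hσ
  have hcoeff := congrArg (fun x : steinberg n F R =>
    (x : R[GL (Fin n) F]).coeff (permGL n F σ)) hs
  rw [coeff_hatChar_smul, coeff_smul_steinberg] at hcoeff
  simp only [coe_smul_steinberg, coeff_of_mul, inv_inv] at hcoeff
  -- Coefficients are compared at w⁻¹w₀. With u = Lv, the element w u w⁻¹w₀ is (wLw⁻¹)w₀ times an
  -- element of B; the two character values cancel, so the sum is |U| times a sign.
  have hterm (u : unip n F) : conjChar (blockChar ψ β) u *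
      (charVec (conjChar (blockChar ψ γ)) : R[GL (Fin n) F]).coeff
        (permGL n F w * (u * permGL n F σ)) = signRev R n := by
    have hfac : permGL n F w * (u * permGL n F σ) =
        permGL n F w * blockDiag β u * (permGL n F w)⁻¹ * permGL n F Fin.revPerm *
          ((permGL n F σ)⁻¹ * ((blockDiag β u)⁻¹ * u) * permGL n F σ) := by
      rw [hσ, map_mul, map_inv]
      group
    rw [hfac, coeff_mul_right_of_mem (SetLike.coe_mem _) _
      (mem_patt.1 (blockDiag_inv_mul_mem_patt hβ u)).2,
      coeff_charVec_mul _ ⟨_, conj_blockDiag_mem_unip (β := β) u⟩, conjChar_apply,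
      conjChar_apply, inv_inv, blockChar_conj_blockDiag ψ hβ hγ, ← mul_assoc, char_inv_mul,
      one_mul, coeff_charVec_permGL, Fintype.sum_eq_single 1]
    · change _ * conjChar (blockChar ψ γ) 1 = _
      rw [map_one, mul_one, signRev]
    · intro v hv
      exact absurd (Subtype.ext (eq_one_of_mem_patt_rev v.2)) hv
  rw [Finset.sum_congr rfl fun u _ => hterm u, Finset.sum_const, Finset.card_univ,
    nsmul_eq_mul, ← Nat.card_eq_fintype_card] at hcoeff
  have hsign : IsUnit (signRev R n) := IsUnit.of_mul_eq_one _ (sign_mul_sign _)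
  exact isUnit_of_mul_isUnit_left (hcoeff ▸ hU.mul hsign)

/-- The component of a translate of the vector attached to `P` along the generic vector is the
index of `P` up to an invertible factor. -/
theorem exists_isUnit_mul_index (hU : IsUnit (Nat.card (unip n F) : R)) {ψ : AddChar F R}
    (hψ : ψ ≠ 1) {P : Subgroup (GL (Fin n) F)} (hP : borel n F ≤ P) {γ : Fin n → ℕ}
    (hγ : ∀ a b, γ a = γ b) :
    ∃ s : R, IsUnit s ∧ steinbergForm n F R (hatChar (blockChar ψ γ) •
      MonoidAlgebra.of R _ (permGL n F (blockRev (block P))) •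
        charVec (blockChar ψ (block P))) (generator n F R) = s * (P.index : R) := by
  obtain ⟨s, hs, h⟩ := exists_isUnit_hatChar_smul hU (block_monotone hP) hγ ψ
  -- The factor |U| lets `charVec` be replaced by its image under `hatChar`, which can then be moved
  -- across the form.
  refine ⟨s, hs, hU.mul_left_cancel ?_⟩
  rw [steinbergForm_hatChar_smul, steinbergForm_of_smul]
  change _ * steinbergForm n F R _ (_ • charVec _) = _
  rw [← smul_eq_mul, ← LinearMap.smul_apply, ← LinearMap.map_smul, ← hatChar_smul_charVec,
    steinbergForm_hatChar_smul, h, LinearMap.map_smul]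
  conv_lhs => rw [charVec.eq_1 (conjChar _)]
  rw [← steinbergForm_hatChar_smul, hatChar_smul_charVec, LinearMap.map_smul,
    LinearMap.smul_apply, steinbergForm_charVec_blockChar hψ hP, smul_eq_mul, smul_eq_mul]
  ring

end Unit

/-! ### Reduction modulo ℓ. -/

section ReductionMap

variable {R G : Type*} [CommRing R] [Group G] {ℓ : ℕ}
  {M : Type*} [AddCommGroup M] [Module R M] [Module R[G] M] [IsScalarTower R R[G] M]
  {N : Type*} [AddCommGroup N] [Module R N] [Module R[G] N] [IsScalarTower R R[G] N]

variable (R G ℓ) in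
/-- The reduction map `M → M / ℓ M`. -/
noncomputable def toReduction (m : M) : Reduction R G ℓ M :=
  (reductionRep R G ℓ M).asModuleEquiv.symm (Submodule.Quotient.mk m)

theorem toReduction_surjective : Function.Surjective (toReduction R G ℓ (M := M)) :=
  fun x => Submodule.Quotient.mk_surjective _ x

theorem toReduction_add (m m' : M) :
    toReduction R G ℓ (m + m') = toReduction R G ℓ m + toReduction R G ℓ m' := rfl

theorem toReduction_eq_zero_iff {m : M} :
    toReduction R G ℓ m = 0 ↔ ∃ z : M, m = (ℓ : R) • z := by
  change (Submodule.Quotient.mk m : M ⧸ (Ideal.span {(ℓ : R)} • (⊤ : Submodule R M))) = 0 ↔ _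
  rw [Submodule.Quotient.mk_eq_zero, Submodule.ideal_span_singleton_smul,
    Submodule.mem_smul_pointwise_iff_exists]
  simp [eq_comm]

theorem toReduction_eq_iff {m m' : M} :
    toReduction R G ℓ m = toReduction R G ℓ m' ↔ ∃ z : M, m - m' = (ℓ : R) • z := by
  rw [← toReduction_eq_zero_iff (G := G), ← sub_eq_zero]
  rfl

variable (R G ℓ) in
/-- The reduction of coefficients `RG → KG`. -/
noncomputable def reduceCoeff : R[G] →+* (R ⧸ Ideal.span {(ℓ : R)})[G] :=
  MonoidAlgebra.mapRingHom G (Ideal.Quotient.mk (Ideal.span {(ℓ : R)}))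

theorem reduceCoeff_surjective : Function.Surjective (reduceCoeff R G ℓ) :=
  MonoidAlgebra.map_surjective _ Ideal.Quotient.mk_surjective

theorem reduceCoeff_smul_toReduction (a : R[G]) (m : M) :
    reduceCoeff R G ℓ a • toReduction R G ℓ m = toReduction R G ℓ (a • m) := by
  induction a using MonoidAlgebra.induction with
  | zero =>
    rw [map_zero, zero_smul, zero_smul]
    rfl
  | single_add g r f _ _ ih =>
    rw [map_add, add_smul, add_smul, toReduction_add, ih]
    congr 1
    rw [reduceCoeff, MonoidAlgebra.mapRingHom_single, Representation.single_smul]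
    have h : MonoidAlgebra.single g r • m = r • MonoidAlgebra.of R G g • m := by
      rw [← smul_assoc, MonoidAlgebra.of_apply, MonoidAlgebra.smul_single', mul_one]
    rw [h]
    rfl

theorem toReduction_linearEquiv_eq (e : M ≃ₗ[R[G]] N) {m m' : M}
    (h : toReduction R G ℓ m = toReduction R G ℓ m') :
    toReduction R G ℓ (e m) = toReduction R G ℓ (e m') := by
  rw [toReduction_eq_iff] at h ⊢
  obtain ⟨z, hz⟩ := h
  refine ⟨e z, ?_⟩
  -- The map `e` is linear over RG, so the scalar ℓ is rewritten as the element ℓ · 1 of RG.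
  rw [← map_sub, hz, ← one_smul R[G] z, ← smul_assoc, map_smul, smul_assoc, map_smul, one_smul]

/-- Isomorphic `RG`-modules have isomorphic reductions. -/
theorem nonempty_reduction_equiv (e : M ≃ₗ[R[G]] N) :
    Nonempty (Reduction R G ℓ M ≃ₗ[(R ⧸ Ideal.span {(ℓ : R)})[G]] Reduction R G ℓ N) := by
  let f (x : Reduction R G ℓ M) : Reduction R G ℓ N :=
    toReduction R G ℓ (e (Function.surjInv toReduction_surjective x))
  let g (x : Reduction R G ℓ N) : Reduction R G ℓ M :=
    toReduction R G ℓ (e.symm (Function.surjInv toReduction_surjective x))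
  have hf (m : M) : f (toReduction R G ℓ m) = toReduction R G ℓ (e m) :=
    toReduction_linearEquiv_eq e (Function.surjInv_eq _ _)
  have hg (m : N) : g (toReduction R G ℓ m) = toReduction R G ℓ (e.symm m) :=
    toReduction_linearEquiv_eq e.symm (Function.surjInv_eq _ _)
  exact ⟨{
    toFun := f
    invFun := g
    map_add' := fun x y => by
      obtain ⟨m, rfl⟩ := toReduction_surjective x
      obtain ⟨m', rfl⟩ := toReduction_surjective y
      rw [← toReduction_add, hf, hf, hf, map_add, toReduction_add]
    map_smul' := fun a x => by
      obtain ⟨b, rfl⟩ := reduceCoeff_surjective a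
      obtain ⟨m, rfl⟩ := toReduction_surjective x
      rw [reduceCoeff_smul_toReduction, hf, hf, map_smul, RingHom.id_apply,
        reduceCoeff_smul_toReduction]
    left_inv := fun x => by
      obtain ⟨m, rfl⟩ := toReduction_surjective x
      rw [hf, hg, LinearEquiv.symm_apply_apply]
    right_inv := fun x => by
      obtain ⟨m, rfl⟩ := toReduction_surjective x
      rw [hg, hf, LinearEquiv.apply_symm_apply] }⟩

end ReductionMap

/-! ### Divisibility by ℓ in R. -/

section LocalRing

variable {R : Type*} [CommRing R] [IsLocalRing R] {ℓ : ℕ}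

theorem isUnit_iff_not_dvd (hmax : IsLocalRing.maximalIdeal R = Ideal.span {(ℓ : R)}) (r : R) :
    IsUnit r ↔ ¬ (ℓ : R) ∣ r := by
  rw [← Ideal.mem_span_singleton, ← hmax, IsLocalRing.mem_maximalIdeal, mem_nonunits_iff, not_not]

theorem isUnit_natCast_of_coprime (hmax : IsLocalRing.maximalIdeal R = Ideal.span {(ℓ : R)})
    {m : ℕ} (h : m.Coprime ℓ) : IsUnit (m : R) := by
  rw [isUnit_iff_not_dvd hmax]
  intro hdvd
  have h1 : IsUnit (ℓ : R) := by
    have hc : IsCoprime (m : R) (ℓ : R) := by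
      have := (Nat.isCoprime_iff_coprime.2 h).map (Int.castRingHom R)
      simpa using this
    exact hc.isUnit_of_dvd' hdvd dvd_rfl
  exact (isUnit_iff_not_dvd hmax _).1 h1 dvd_rfl

theorem pow_dvd_natCast_iff [IsDomain R] [CharZero R] (hℓ : ℓ.Prime)
    (hmax : IsLocalRing.maximalIdeal R = Ideal.span {(ℓ : R)}) {m : ℕ} (hm : m ≠ 0) (k : ℕ) :
    (ℓ : R) ^ k ∣ (m : R) ↔ ℓ ^ k ∣ m := by
  refine ⟨fun h => ?_, fun h => by simpa using Nat.cast_dvd_cast (α := R) h⟩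
  obtain ⟨a, m', hm', rfl⟩ := Nat.exists_eq_pow_mul_and_not_dvd hm ℓ hℓ.ne_one
  have hu : IsUnit (m' : R) :=
    isUnit_natCast_of_coprime hmax (((Nat.Prime.coprime_iff_not_dvd hℓ).2 hm').symm)
  rw [Nat.cast_mul, Nat.cast_pow, hu.dvd_mul_right] at h
  have hnu : ¬ IsUnit (ℓ : R) := fun h => (isUnit_iff_not_dvd hmax _).1 h dvd_rfl
  have hℓ0 : (ℓ : R) ≠ 0 := Nat.cast_ne_zero.2 hℓ.ne_zero
  exact (pow_dvd_pow ℓ ((pow_dvd_pow_iff hℓ0 hnu).1 h)).trans (dvd_mul_right _ _)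

end LocalRing

/-! ### A nontrivial additive character, and the order of U. -/

section Field

/-- The character is ζ raised to the trace to the prime field; it is nontrivial because the trace is
surjective. -/
theorem exists_addChar_ne_one {p : ℕ} {F : Type*} [Field F] [Finite F] [CharP F p] {R : Type*}
    [CommRing R] {ζ : R} (hζ : IsPrimitiveRoot ζ p) : ∃ ψ : AddChar F R, ψ ≠ 1 := by
  have hp : p.Prime :=
    (CharP.char_is_prime_or_zero F p).resolve_right (CharP.char_ne_zero_of_finite F p)
  have : Fact p.Prime := ⟨hp⟩
  let _ : Algebra (ZMod p) F := ZMod.algebra F p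
  obtain ⟨x, hx⟩ := Algebra.trace_surjective (ZMod p) F 1
  refine ⟨(AddChar.zmodChar p hζ.pow_eq_one).compAddMonoidHom
    (Algebra.trace (ZMod p) F).toAddMonoidHom, fun h => ?_⟩
  have h1 := DFunLike.congr_fun h x
  have h2 : AddChar.zmodChar p hζ.pow_eq_one 1 = 1 := by
    rw [← hx]
    exact h1
  rw [AddChar.zmodChar_apply, ZMod.val_one, pow_one] at h2
  exact hζ.ne_one hp.one_lt h2

theorem coprime_card_unip {p ℓ n : ℕ} {F : Type*} [Field F] [Finite F] [CharP F p]
    (hℓ : ℓ.Prime) (hℓp : ℓ ≠ p) : (Nat.card (unip n F)).Coprime ℓ := by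
  have hp : p.Prime :=
    (CharP.char_is_prime_or_zero F p).resolve_right (CharP.char_ne_zero_of_finite F p)
  have := Fintype.ofFinite F
  obtain ⟨k, -, hk⟩ := FiniteField.card F p
  rw [← patt_one, card_patt, Nat.card_eq_fintype_card, hk]
  exact (((Nat.coprime_primes hp hℓ).2 hℓp.symm).pow_left _).pow_left _

end Field

/-! ### The lattices I(c) and their reductions. -/

section Filtration

variable {n : ℕ} {F : Type*} [Field F] [Finite F] {R : Type*} [CommRing R] [IsDomain R]
  [CharZero R] {ℓ : ℕ}

theorem mem_lattice {c : ℕ} {x : steinberg n F R} :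
    x ∈ lattice n F R ℓ c ↔ ∀ y, (ℓ : R) ^ c ∣ steinbergForm n F R x y :=
  forall_congr' fun _ => Ideal.mem_span_singleton

theorem smul_charVec_mem_lattice {χ : unip n F →* R} {r : R} {c : ℕ} :
    r • charVec χ ∈ lattice n F R ℓ c ↔
      (ℓ : R) ^ c ∣ r * steinbergForm n F R (charVec χ) (generator n F R) := by
  rw [mem_lattice]
  simp only [LinearMap.map_smul, LinearMap.smul_apply, smul_eq_mul]
  refine ⟨fun h => h _, fun h y => ?_⟩
  obtain ⟨s, hs⟩ := steinbergForm_charVec χ y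
  rw [hs, ← mul_assoc]
  exact h.mul_right s

theorem steinbergForm_charVec_one :
    steinbergForm n F R (charVec 1) (generator n F R) = ((borel n F).index : R) := by
  classical
  rw [steinbergForm_charVec_generator, index_eq_sum_patt le_rfl, Nat.cast_sum]
  refine Finset.sum_congr rfl fun σ _ => ?_
  rw [if_pos (invDecOn_block_borel σ)]
  simp [Nat.card_eq_fintype_card]

/-- The element of `RG` that distinguishes the reductions of the lattices. -/
noncomputable def testElement (ψ : AddChar F R) (P : Subgroup (GL (Fin n) F)) : R[GL (Fin n) F] :=
  hatChar (blockChar ψ (block (⊤ : Subgroup (GL (Fin n) F)))) *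
    (MonoidAlgebra.of R _ (permGL n F (blockRev (block P))) *
      hatChar (blockChar ψ (block P)))

/-- The test element kills T^c for c < a: already `hatChar` for P sends all of I into I(a). -/
theorem testElement_smul_eq {ψ : AddChar F R} (hψ : ψ ≠ 1) {P : Subgroup (GL (Fin n) F)}
    (hP : borel n F ≤ P) {a c : ℕ} (ha : (ℓ : R) ^ a ∣ (P.index : R)) (hc : c < a)
    (y : steinberg n F R) :
    ∃ z ∈ lattice n F R ℓ c, testElement ψ P • y = (ℓ : R) • z := by
  obtain ⟨r, hr⟩ := hatChar_smul_eq (blockChar ψ (block P)) y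
  have hmem : r • charVec (blockChar ψ (block P)) ∈ lattice n F R ℓ a := by
    rw [smul_charVec_mem_lattice, steinbergForm_charVec_blockChar hψ hP]
    exact ha.mul_left r
  have hmem' : testElement ψ P • y ∈ lattice n F R ℓ a := by
    rw [testElement, mul_smul, mul_smul, hr]
    exact Submodule.smul_mem _ _ (Submodule.smul_mem _ _ hmem)
  obtain ⟨s, hs⟩ := hatChar_smul_eq (blockChar ψ (block (⊤ : Subgroup (GL (Fin n) F))))
    ((MonoidAlgebra.of R _ (permGL n F (blockRev (block P))) *
      hatChar (blockChar ψ (block P))) • y)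
  rw [testElement, mul_smul, hs] at hmem' ⊢
  -- For the generic vector the index is 1, so membership in I(a) means that the scalar itself is
  -- divisible by ℓ^a.
  rw [smul_charVec_mem_lattice, steinbergForm_charVec_blockChar hψ le_top, Subgroup.index_top,
    Nat.cast_one, mul_one] at hmem'
  obtain ⟨t, rfl⟩ := (pow_dvd_pow _ hc).trans hmem'
  refine ⟨((ℓ : R) ^ c * t) • charVec
    (blockChar ψ (block (⊤ : Subgroup (GL (Fin n) F)))), ?_, ?_⟩
  · rw [smul_charVec_mem_lattice, mul_assoc]
    exact dvd_mul_right _ _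
  · rw [smul_smul, pow_succ']
    congr 1
    ring

/-- The witness ℓ^(h-a) v_P is sent to a vector whose pairing with 𝐞 is a unit times ℓ^(h-a)[G:P],
not divisible by ℓ^(h+1). -/
theorem exists_testElement_smul_ne (hU : IsUnit (Nat.card (unip n F) : R)) (hℓ0 : (ℓ : R) ≠ 0)
    {ψ : AddChar F R} (hψ : ψ ≠ 1) {P : Subgroup (GL (Fin n) F)} (hP : borel n F ≤ P) {a h : ℕ}
    (ha : (ℓ : R) ^ a ∣ (P.index : R)) (ha' : ¬ (ℓ : R) ^ (a + 1) ∣ (P.index : R)) (hah : a ≤ h) :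
    ∃ y ∈ lattice n F R ℓ h, ∀ z ∈ lattice n F R ℓ h, testElement ψ P • y ≠ (ℓ : R) • z := by
  refine ⟨(ℓ : R) ^ (h - a) • charVec (blockChar ψ (block P)), ?_, fun z hz heq => ha' ?_⟩
  · rw [smul_charVec_mem_lattice, steinbergForm_charVec_blockChar hψ hP]
    conv_lhs => rw [← Nat.sub_add_cancel hah, pow_add]
    exact mul_dvd_mul_left _ ha
  obtain ⟨s, hs, hform⟩ := exists_isUnit_mul_index hU hψ hP
    (block_top_eq : ∀ a b : Fin n, block (⊤ : Subgroup (GL (Fin n) F)) a = block ⊤ b)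
  have h1 : testElement ψ P • (ℓ : R) ^ (h - a) • charVec (blockChar ψ (block P)) =
      ((ℓ : R) ^ (h - a) * (Nat.card (unip n F) : R)) •
        hatChar (blockChar ψ (block (⊤ : Subgroup (GL (Fin n) F)))) •
        MonoidAlgebra.of R _ (permGL n F (blockRev (block P))) •
        charVec (blockChar ψ (block P)) := by
    rw [testElement, mul_smul, mul_smul, smul_comm (hatChar (blockChar ψ (block P))),
      hatChar_smul_charVec, smul_smul ((ℓ : R) ^ (h - a)), smul_comm (MonoidAlgebra.of R _ _), smul_comm (hatChar _)]
  have h2 := congrArg (fun x => steinbergForm n F R x (generator n F R)) (h1.symm.trans heq)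
  simp only [LinearMap.map_smul, LinearMap.smul_apply, hform, smul_eq_mul] at h2
  obtain ⟨t, ht⟩ := mem_lattice.1 hz (generator n F R)
  rw [ht] at h2
  have hdvd : (ℓ : R) ^ (h - a) * (ℓ : R) ^ (a + 1) ∣
      (ℓ : R) ^ (h - a) * ((Nat.card (unip n F) * s : R) * (P.index : R)) := by
    refine ⟨t, ?_⟩
    rw [← pow_add, show h - a + (a + 1) = h + 1 by omega, pow_succ']
    linear_combination h2
  exact (hU.mul hs).dvd_mul_left.1 ((mul_dvd_mul_iff_left (pow_ne_zero _ hℓ0)).1 hdvd)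

/-- An element of `I(i + 1)` is divisible by `ℓ` if `ℓ ^ (i + 1)` does not divide `[G : B]`. -/
theorem exists_eq_smul_of_mem_lattice [IsLocalRing R]
    (hmax : IsLocalRing.maximalIdeal R = Ideal.span {(ℓ : R)})
    (hU : IsUnit (Nat.card (unip n F) : R)) {c : ℕ}
    (hc : ¬ (ℓ : R) ^ c ∣ ((borel n F).index : R)) {x : steinberg n F R}
    (hx : x ∈ lattice n F R ℓ c) : ∃ y : steinberg n F R, x = (ℓ : R) • y := by
  by_cases hdvd : ∀ u : unip n F,
      (ℓ : R) ∣ (x : R[GL (Fin n) F]).coeff (u * permGL n F Fin.revPerm)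
  · choose r hr using hdvd
    refine ⟨signRev R n • ∑ u : unip n F, r u •
      MonoidAlgebra.of R _ (u : GL (Fin n) F) • generator n F R, ?_⟩
    conv_lhs => rw [eq_sum_bigCell x]
    simp only [hr, mul_smul]
    rw [← Finset.smul_sum, smul_comm]
  push Not at hdvd
  obtain ⟨u, hu⟩ := hdvd
  set k : R := (x : R[GL (Fin n) F]).coeff (u * permGL n F Fin.revPerm)
  -- After translation by `g` the coefficient `k` sits at the identity and, by invariance under B on
  -- the right, on all of U. Summation over U then yields k times the vector of the trivial
  -- character.
  let g : GL (Fin n) F := (u * permGL n F Fin.revPerm)⁻¹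
  obtain ⟨r, hr⟩ := hatChar_smul_eq 1 (MonoidAlgebra.of R _ g • x)
  have hcoeff := congrArg (fun y : steinberg n F R =>
    (y : R[GL (Fin n) F]).coeff (permGL n F 1)) hr
  have hterm (v : unip n F) : ((MonoidAlgebra.of R _ g • x : steinberg n F R) :
      R[GL (Fin n) F]).coeff (v * permGL n F 1) = k := by
    rw [coe_smul_steinberg, coeff_of_mul, map_one, mul_one,
      coeff_mul_right_of_mem x.2 _ (unip_le_borel v.2), inv_inv]
  have hcard : (charVec (1 : unip n F →* R) : R[GL (Fin n) F]).coeff (permGL n F 1) =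
      (Nat.card (unip n F) : R) := by
    rw [coeff_charVec_permGL]
    simp [← patt_one, Nat.card_eq_fintype_card]
  rw [coeff_hatChar_smul, coeff_smul_steinberg, hcard] at hcoeff
  simp only [hterm, MonoidHom.one_apply, one_mul, Finset.sum_const, Finset.card_univ,
    nsmul_eq_mul, ← Nat.card_eq_fintype_card] at hcoeff
  rw [mul_comm] at hcoeff
  have hrk : k = r := hU.mul_right_cancel hcoeff
  have hmem : r • charVec (1 : unip n F →* R) ∈ lattice n F R ℓ c := by
    rw [← hr]
    exact Submodule.smul_mem _ _ (Submodule.smul_mem _ _ hx)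
  rw [smul_charVec_mem_lattice, steinbergForm_charVec_one, ← hrk] at hmem
  exact absurd (((isUnit_iff_not_dvd hmax k).2 hu).dvd_mul_left.1 hmem) hc

/-- The isomorphism is multiplication by ℓ; the divisibility hypothesis is its surjectivity. -/
theorem nonempty_lattice_equiv (hℓ0 : (ℓ : R) ≠ 0) {i : ℕ}
    (hdvd : ∀ x ∈ lattice n F R ℓ (i + 1), ∃ y : steinberg n F R, x = (ℓ : R) • y) :
    Nonempty (lattice n F R ℓ i ≃ₗ[R[GL (Fin n) F]] lattice n F R ℓ (i + 1)) := by
  let f : lattice n F R ℓ i →ₗ[R[GL (Fin n) F]] lattice n F R ℓ (i + 1) :=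
    { toFun := fun x => ⟨(ℓ : R) • (x : steinberg n F R), mem_lattice.2 fun y => by
        rw [LinearMap.map_smul, LinearMap.smul_apply, smul_eq_mul, pow_succ']
        exact mul_dvd_mul_left _ (mem_lattice.1 x.2 y)⟩
      map_add' := fun x y => Subtype.ext (smul_add _ _ _)
      map_smul' := fun a x => Subtype.ext (smul_comm _ _ _) }
  refine ⟨LinearEquiv.ofBijective f ⟨fun x y h => ?_, fun x => ?_⟩⟩
  · have h1 : (ℓ : R) • (x : steinberg n F R) = (ℓ : R) • (y : steinberg n F R) :=
      congrArg Subtype.val h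
    refine Subtype.ext (Subtype.ext ?_)
    ext g
    have h2 := congrArg (fun z : steinberg n F R => (z : R[GL (Fin n) F]).coeff g) h1
    exact mul_left_cancel₀ hℓ0 h2
  · obtain ⟨y, hy⟩ := hdvd x x.2
    refine ⟨⟨y, mem_lattice.2 fun z => ?_⟩, Subtype.ext hy.symm⟩
    have h1 := mem_lattice.1 x.2 z
    rw [hy, LinearMap.map_smul, LinearMap.smul_apply, smul_eq_mul, pow_succ'] at h1
    exact (mul_dvd_mul_iff_left hℓ0).1 h1

theorem isEmpty_reduction_equiv {c h : ℕ} (a : R[GL (Fin n) F])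
    (h1 : ∀ y ∈ lattice n F R ℓ c, ∃ z ∈ lattice n F R ℓ c, a • y = (ℓ : R) • z)
    (h2 : ∃ y ∈ lattice n F R ℓ h, ∀ z ∈ lattice n F R ℓ h, a • y ≠ (ℓ : R) • z) :
    IsEmpty (Reduction R (GL (Fin n) F) ℓ (lattice n F R ℓ c)
      ≃ₗ[(R ⧸ Ideal.span {(ℓ : R)})[GL (Fin n) F]]
        Reduction R (GL (Fin n) F) ℓ (lattice n F R ℓ h)) := by
  refine ⟨fun φ => ?_⟩
  obtain ⟨y, hy, hne⟩ := h2
  obtain ⟨⟨x, hx⟩, hxy⟩ := toReduction_surjective (φ.symm (toReduction R _ ℓ ⟨y, hy⟩))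
  obtain ⟨z, hz, hxz⟩ := h1 x hx
  have h3 : toReduction R (GL (Fin n) F) ℓ (a • (⟨x, hx⟩ : lattice n F R ℓ c)) = 0 :=
    toReduction_eq_zero_iff.2 ⟨⟨z, hz⟩, Subtype.ext hxz⟩
  rw [← reduceCoeff_smul_toReduction, hxy, ← map_smul, reduceCoeff_smul_toReduction,
    LinearEquiv.map_eq_zero_iff, toReduction_eq_zero_iff] at h3
  obtain ⟨⟨w, hw⟩, h4⟩ := h3
  exact hne w hw (congrArg Subtype.val h4)

end Filtration

end SteinbergLattice

/-! ### The main theorem. -/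

theorem theoremB52 (n : ℕ) (hn : 2 ≤ n) (p ℓ : ℕ)
    (F : Type*) [Field F] [Finite F] [CharP F p]
    (hℓ : ℓ.Prime) (hℓp : ℓ ≠ p)
    (R : Type*) [CommRing R] [IsDomain R] [IsPrincipalIdealRing R] [IsLocalRing R] [CharZero R]
    (hmax : IsLocalRing.maximalIdeal R = Ideal.span {(ℓ : R)})
    (hζ : ∃ ζ : R, IsPrimitiveRoot ζ p) :
    (∀ c h : ℕ, c < h →
      (∃ a : ℕ, SteinbergLattice.IsPValue n F ℓ a ∧ c < a ∧ a ≤ h) →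
      IsEmpty
        (SteinbergLattice.Reduction R (GL (Fin n) F) ℓ (SteinbergLattice.lattice n F R ℓ c)
          ≃ₗ[(R ⧸ Ideal.span {(ℓ : R)})[GL (Fin n) F]]
        SteinbergLattice.Reduction R (GL (Fin n) F) ℓ (SteinbergLattice.lattice n F R ℓ h)) ∧
      IsEmpty
        (SteinbergLattice.lattice n F R ℓ c ≃ₗ[R[GL (Fin n) F]]
          SteinbergLattice.lattice n F R ℓ h)) ∧
    (∀ i : ℕ, SteinbergLattice.maxPValue n F ℓ ≤ i →
      Nonempty
        (SteinbergLattice.lattice n F R ℓ i ≃ₗ[R[GL (Fin n) F]]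
          SteinbergLattice.lattice n F R ℓ (i + 1)) ∧
      Nonempty
        (SteinbergLattice.Reduction R (GL (Fin n) F) ℓ (SteinbergLattice.lattice n F R ℓ i)
          ≃ₗ[(R ⧸ Ideal.span {(ℓ : R)})[GL (Fin n) F]]
        SteinbergLattice.Reduction R (GL (Fin n) F) ℓ
          (SteinbergLattice.lattice n F R ℓ (i + 1)))) := by
  obtain ⟨ζ, hζ⟩ := hζ
  obtain ⟨ψ, hψ⟩ := SteinbergLattice.exists_addChar_ne_one (F := F) hζ
  have hU : IsUnit (Nat.card (SteinbergLattice.unip n F) : R) :=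
    SteinbergLattice.isUnit_natCast_of_coprime hmax
      (SteinbergLattice.coprime_card_unip hℓ hℓp)
  have hℓ0 : (ℓ : R) ≠ 0 := Nat.cast_ne_zero.2 hℓ.ne_zero
  constructor
  · rintro c h - ⟨a, ⟨P, hP, hdvd, hndvd⟩, hca, hah⟩
    have hP0 : P.index ≠ 0 := Subgroup.index_ne_zero_of_finite
    rw [← SteinbergLattice.pow_dvd_natCast_iff hℓ hmax hP0] at hdvd hndvd
    have hempty := SteinbergLattice.isEmpty_reduction_equiv
      (SteinbergLattice.testElement ψ P)
      (fun y _ => SteinbergLattice.testElement_smul_eq hψ hP hdvd hca y)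
      (SteinbergLattice.exists_testElement_smul_ne hU hℓ0 hψ hP hdvd hndvd hah)
    exact ⟨hempty, ⟨fun e => (SteinbergLattice.nonempty_reduction_equiv e).elim hempty.elim⟩⟩
  · intro i hi
    have hB0 : (SteinbergLattice.borel n F).index ≠ 0 := Subgroup.index_ne_zero_of_finite
    have hndvd : ¬ (ℓ : R) ^ (i + 1) ∣ ((SteinbergLattice.borel n F).index : R) := by
      have : Fact ℓ.Prime := ⟨hℓ⟩
      rw [SteinbergLattice.pow_dvd_natCast_iff hℓ hmax hB0, padicValNat_dvd_iff_le hB0]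
      exact not_le.2 (Nat.lt_succ_of_le hi)
    obtain ⟨e⟩ := SteinbergLattice.nonempty_lattice_equiv hℓ0 fun x hx =>
      SteinbergLattice.exists_eq_smul_of_mem_lattice (n := n) (F := F) hmax hU hndvd hx
    exact ⟨⟨e⟩, SteinbergLattice.nonempty_reduction_equiv e⟩
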